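/- Let $N\ge 2$, $n=N^2-1$, $\kappa>0$, and let $\theta_1,\dots,\theta_n$ be traceless self-adjoint complex $N\times N$ matrices with $\mathrm{tr}(\theta_i\theta_j)=\kappa\,\delta_{ij}$ ($\kappa=2$ for the Pauli and Gell-Mann matrices). For $b\in\mathbb R^n$ put $b\cdot\theta=\sum_i b_i\theta_i$ and $U(b)=\exp(i\,b\cdot\theta)\in SU(N)$. Let $f_{ijk}$ be the structure constants in the standard normalization, that is, $f_{ijk}=-2i\,\mathrm{tr}([T_i,T_j]T_k)$ with $T_i=\theta_i/\sqrt{2\kappa}$ (so $\mathrm{tr}\,T_iT_j=\tfrac12\delta_{ij}$), and let $(C_2)_{ij}=\sum_{k,l}f_{ikl}f_{jkl}$ be the quadratic Casimir matrix of the adjoint representation. Let $\mu$ be the normalized Haar measure of $SU(N)$. For $\Phi:\mathbb R^n\to SU(N)$ and $\rho\ge0$ we say that $\rho$ is the density of $\mu$ in the coordinates $\Phi$ if $\mu(\Phi(A))=\int_A\rho(b)\,db$ for every Borel set $A\subset\mathbb R^n$ on which $\Phi$ is injective. Then: 1. The $f_{ijk}$ are real and completely antisymmetric, $[\theta_i,\theta_j]=i\sqrt{2\kappa}\,\sum_k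 f_{ijk}\theta_k$, and $C_2=N\cdot I$. 2. $U$ is injective on some open neighbourhood $V$ of $0$, and $U(V)$ is open in $SU(N)$. There is a map $c(a,b)$, defined near $(0,0)$, with $c(a,b)\to 0$ as $(a,b)\to(0,0)$ and $U(b)\,U(a)=U(c(a,b))$. Every such $c$ is real analytic at $(0,0)$, and the Jacobian matrix $J(b)=\big(\partial c_i/\partial a_j\big)\big|_{a=0}$ satisfies $$\det J(b)=1+\frac{\kappa}{2}\cdot\frac16\,(b,C_2b)+O(|b|^3),\qquad b\to0 .$$ In particular $\det J=1+\frac16(b,C_2b)+O(|b|^3)$ for $\kappa=2$. 3. The Maurer-Cartan form $w=U^{-1}dU$ can be written as $w=i\sum_{j,k}W_{jk}(b)\,db_k\,\theta_j$ with real functions $W_{jk}$ that are real analytic on $\mathbb R^n$. There is a constant $K>0$ such that $\rho(b)=K\det W(b)$ is the density of $\mu$ in the coordinates $U$. This $\rho$ is real analytic on all of $\mathbb R^n$, and for $b$ near $0$ one has $\det J(b)>0$ and $\rho(b)=K/\det J(b)$. 4. (Mass term.) For every $g>0$ the density of $\mu$ in the coordinates $A\mapsto\exp(i g A\cdot\theta)$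 is $\rho_g(A)=g^{n}\rho(gA)$. There are $r>0$ and $C$, independent of $g$, such that $\rho_g(A)>0$ and $$\Big|-\ln\rho_g(A)-\Big(-\ln(g^nK)+g^2\,\frac{\kappa}{2}\cdot\frac{N}{6}\,|A|^2\Big)\Big|\le C\,|gA|^3\qquad\text{whenever } |gA|<r .$$ So the exponent of the density has a positive local mass term, whose coefficient is proportional to $g^2$ times the Casimir eigenvalue $N$. -/

import Mathlib

open Matrix Filter Topology MeasureTheory Asymptotics

noncomputable section

/-- Generators `θ_1, …, θ_{N²-1}` of the Lie algebra of `SU(N)`: traceless self-adjoint matrices with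
`tr (θ_i θ_j) = κ δ_{ij}`. The Pauli matrices (`N = 2`) and the Gell-Mann matrices (`N = 3`) have
`κ = 2`. -/
structure Generators (N : ℕ) (κ : ℝ) where
  θ : Fin (N ^ 2 - 1) → Matrix (Fin N) (Fin N) ℂ
  isHermitian : ∀ i, (θ i).IsHermitian
  trace_eq_zero : ∀ i, (θ i).trace = 0
  trace_mul : ∀ i j, (θ i * θ j).trace = if i = j then (κ : ℂ) else 0

/-- The space `ℝ^{N²-1}` of gluon coordinates, with the Euclidean norm and Lebesgue measure. -/
abbrev GluonSpace (N : ℕ) : Type := EuclideanSpace ℝ (Fin (N ^ 2 - 1))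

namespace Generators

variable {N : ℕ} {κ : ℝ}

/-- The matrix `b · θ = ∑ b_i θ_i`. -/
def dot (G : Generators N κ) (b : GluonSpace N) : Matrix (Fin N) (Fin N) ℂ :=
  ∑ i, (b i : ℂ) • G.θ i

theorem dot_isHermitian (G : Generators N κ) (b : GluonSpace N) : (G.dot b).IsHermitian := by
  unfold dot Matrix.IsHermitian
  rw [conjTranspose_sum]
  refine Finset.sum_congr rfl fun i _ => ?_
  rw [conjTranspose_smul, (G.isHermitian i).eq]
  simp

theorem dot_trace (G : Generators N κ) (b : GluonSpace N) : (G.dot b).trace = 0 := by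
  simp [dot, trace_sum, trace_smul, G.trace_eq_zero]

end Generators

/-- `exp (i H)` is special unitary when `H` is self-adjoint and traceless. -/
theorem exp_I_smul_mem {N : ℕ} {H : Matrix (Fin N) (Fin N) ℂ} (hH : H.IsHermitian)
    (ht : H.trace = 0) :
    NormedSpace.exp (Complex.I • H) ∈ specialUnitaryGroup (Fin N) ℂ := by
  rw [mem_specialUnitaryGroup_iff, mem_unitaryGroup_iff]
  constructor
  · rw [star_eq_conjTranspose, ← exp_conjTranspose, conjTranspose_smul, hH.eq]
    have hc : Commute (Complex.I • H) (star Complex.I • H) :=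
      ((Commute.refl H).smul_left _).smul_right _
    rw [← Matrix.exp_add_of_commute _ _ hc]
    simp
  · set V : Matrix (Fin N) (Fin N) ℂ := (hH.eigenvectorUnitary : Matrix (Fin N) (Fin N) ℂ) with hV
    have hVV : V * star V = 1 := mem_unitaryGroup_iff.1 hH.eigenvectorUnitary.2
    have hinv : V⁻¹ = star V := inv_eq_right_inv hVV
    have hunit : IsUnit V := (isUnit_iff_isUnit_det V).2 (isUnit_det_of_right_inverse hVV)
    have hspec : H = V * diagonal (fun i => (hH.eigenvalues i : ℂ)) * V⁻¹ := by
      rw [hinv]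
      exact hH.spectral_theorem
    have h2 : Complex.I • H
        = V * diagonal (fun i => Complex.I * (hH.eigenvalues i : ℂ)) * V⁻¹ := by
      have : diagonal (fun i => Complex.I * (hH.eigenvalues i : ℂ))
          = Complex.I • diagonal (fun i => (hH.eigenvalues i : ℂ)) := by
        ext i j; simp [diagonal_apply]
      rw [this, mul_smul_comm, smul_mul_assoc, ← hspec]
    have hsum : ∑ i, (hH.eigenvalues i : ℂ) = 0 := by
      rw [← ht]; exact hH.trace_eq_sum_eigenvalues.symm
    rw [h2, Matrix.exp_conj _ _ hunit, det_conj hunit, exp_diagonal, det_diagonal]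
    have : ∀ i, (NormedSpace.exp fun i => Complex.I * (hH.eigenvalues i : ℂ)) i
        = Complex.exp (Complex.I * (hH.eigenvalues i : ℂ)) := by
      intro i
      rw [Pi.coe_exp, Complex.exp_eq_exp_ℂ]
    rw [Finset.prod_congr rfl fun i _ => this i, ← Complex.exp_sum, ← Finset.mul_sum, hsum]
    simp

namespace Generators

variable {N : ℕ} {κ : ℝ}

/-- Exponential (gluon) coordinates on `SU(N)`: `U(b) = exp (i b · θ)`. -/
def U (G : Generators N κ) (b : GluonSpace N) : specialUnitaryGroup (Fin N) ℂ :=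
  ⟨NormedSpace.exp (Complex.I • G.dot b), exp_I_smul_mem (G.dot_isHermitian b) (G.dot_trace b)⟩

/-- The structure constants of `SU(N)`, in their standard normalization: with
`T_i = θ_i / √(2κ)`, so that `tr (T_i T_j) = δ_{ij} / 2`, they are given by
`[T_i, T_j] = i ∑_k f_{ijk} T_k`, that is, `f_{ijk} = -2 i tr ([T_i, T_j] T_k)`. -/
def f (G : Generators N κ) (i j k : Fin (N ^ 2 - 1)) : ℝ :=
  (κ * √(2 * κ))⁻¹ * (((G.θ i * G.θ j - G.θ j * G.θ i) * G.θ k).trace).im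

/-- The quadratic Casimir matrix in the adjoint representation: `(C₂)_{ij} = f_{ikl} f_{jkl}`. -/
def casimir (G : Generators N κ) : Matrix (Fin (N ^ 2 - 1)) (Fin (N ^ 2 - 1)) ℝ :=
  Matrix.of fun i j => ∑ k, ∑ l, G.f i k l * G.f j k l

/-- The quadratic form `(b, C₂ b)`. -/
def casimirForm (G : Generators N κ) (b : GluonSpace N) : ℝ :=
  ∑ i, ∑ j, b i * G.casimir i j * b j

/-- `c = c(a, b)` is the multiplication of `SU(N)` in gluon coordinates near the identity:
`exp (i b · θ) exp (i a · θ) = exp (i c · θ)` for `(a, b)` near `(0, 0)`, with `c` near `0`.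
Since `U` is injective near `0`, the germ of `c` at `(0, 0)` is determined by this. -/
def IsLocalProduct (G : Generators N κ) (c : GluonSpace N → GluonSpace N → GluonSpace N) : Prop :=
  Tendsto (fun p : GluonSpace N × GluonSpace N => c p.1 p.2) (𝓝 (0, 0)) (𝓝 0) ∧
    ∀ᶠ p : GluonSpace N × GluonSpace N in 𝓝 (0, 0), G.U p.2 * G.U p.1 = G.U (c p.1 p.2)

/-- The matrix one-form `w = U⁻¹ dU` at the point `b`, applied to the tangent vector `v`. -/
def maurerCartan (G : Generators N κ) (b v : GluonSpace N) : Matrix (Fin N) (Fin N) ℂ :=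
  (((G.U b)⁻¹ : specialUnitaryGroup (Fin N) ℂ) : Matrix (Fin N) (Fin N) ℂ) *
    Matrix.of fun p q => fderiv ℝ (fun b' => (G.U b' : Matrix (Fin N) (Fin N) ℂ) p q) b v

/-- The matrix of the components of the Maurer-Cartan form: `w = i ∑_j w_j θ_j`, where
`w_j = ∑_k W_{jk}(b) db_k`. Hence `w_1 ∧ … ∧ w_n = det W(b) db_1 ∧ … ∧ db_n`. -/
def mcMatrix (G : Generators N κ) (b : GluonSpace N) :
    Matrix (Fin (N ^ 2 - 1)) (Fin (N ^ 2 - 1)) ℝ :=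
  Matrix.of fun j k =>
    κ⁻¹ * ((G.θ j * G.maurerCartan b (EuclideanSpace.single k 1)).trace).im

end Generators

/-- The Jacobian matrix `J(b) = (∂c_i/∂a_j)` at `a = 0` of the map `a ↦ c(a, b)`. -/
def jacobianAtZero {N : ℕ} (c : GluonSpace N → GluonSpace N → GluonSpace N) (b : GluonSpace N) :
    Matrix (Fin (N ^ 2 - 1)) (Fin (N ^ 2 - 1)) ℝ :=
  Matrix.of fun i j => fderiv ℝ (fun a => c a b i) 0 (EuclideanSpace.single j 1)

/-- `ρ ≥ 0` is the density of the measure `μ` with respect to Lebesgue measure in the coordinates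
given by `Φ`: `μ (Φ(A)) = ∫_A ρ(b) db` for each Borel set `A` on which `Φ` is injective. -/
def IsDensityInCoordinates {N : ℕ} [MeasurableSpace (specialUnitaryGroup (Fin N) ℂ)]
    (μ : Measure (specialUnitaryGroup (Fin N) ℂ))
    (Φ : GluonSpace N → specialUnitaryGroup (Fin N) ℂ) (ρ : GluonSpace N → ℝ) : Prop :=
  (∀ b, 0 ≤ ρ b) ∧
    ∀ A : Set (GluonSpace N), MeasurableSet A → Set.InjOn Φ A →
      μ (Φ '' A) = ∫⁻ b in A, ENNReal.ofReal (ρ b)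

end

/-! Haar measure of `SU(N)` in exponential coordinates. -/

noncomputable section

/-! ### The trace form: completeness of the generators, structure constants, Casimir matrix. -/

namespace Generators

variable {N : ℕ} {κ : ℝ}

/-! The algebraic part rests on the trace form: the `θ_k` together with the identity are an
orthogonal basis of all complex matrices, which gives Parseval's identity and the Fierz identity,
and with these `casimir_eq`.

Let `W` be the matrix of the Maurer-Cartan form. Left invariance (`maurerCartan_pullback`) says that
a map `ψ` which is a left translation in gluon coordinates satisfies `W(ψ b) Dψ = W(b)`. Applied to
`a ↦ c(a, b)` at `a = 0`, where `W = 1`, it gives `W(b) J(b) = 1`. Applied in the change of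
variables formula, it says that `|det W| db` is invariant under translations.

The finer facts on `det W` come from one functional equation instead of a series for the derivative
of `exp`. Differentiating `U(2b) = U(b)²` gives `2 W(2b) = (1 + Ad) W(b)`, with `Ad` the matrix of
`X ↦ U(b)⁻¹ X U(b)`. Sign: `Ad = S²`, where `S` belongs to `b/2`, and `det (1 + S²) = |det (1 +
iS)|² ≥ 0`. Hence `det W ≥ 0` spreads by doubling from a neighbourhood of `0` to all `b`, and the
absolute value in the invariant density can be dropped. Expansion: let `M` be the matrix of `ad (i b
· θ)`. Along `t ↦ tb` the factor `(1 + Ad)/2` agrees up to `O(t³)` with the inverse of `1 + tM/2`.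
As `M` is antisymmetric, `det (1 + tM/2)² = det (1 - t²M²/4)`, whose `t²` term is the Casimir form.
Comparing coefficients in the functional equation determines `det W` to second order, and then `det
J = 1 / det W`.

For the Haar measure, a Fubini argument (`mul_eq_mul_of_locally_invariant`) shows that a locally
left invariant finite measure on an open set is a multiple of Haar measure there. The image of `det
W db` under a chart at the identity is such a measure. Countably many translates of the chart cover
everything, so the formula with the same constant holds on every Borel set where `U` is injective.
-/

theorem dot_add (G : Generators N κ) (a b : GluonSpace N) : G.dot (a + b) = G.dot a + G.dot b := by
  simp [dot, add_smul, Finset.sum_add_distrib]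

theorem dot_smul (G : Generators N κ) (t : ℝ) (b : GluonSpace N) :
    G.dot (t • b) = t • G.dot b := by
  simp [dot, Finset.smul_sum, mul_smul]

theorem trace_mul_dot (G : Generators N κ) (j : Fin (N ^ 2 - 1)) (b : GluonSpace N) :
    (G.θ j * G.dot b).trace = κ * b j := by
  simp [dot, Finset.mul_sum, trace_sum, G.trace_mul, mul_comm]

/-- The generators together with the identity matrix. -/
def extended (G : Generators N κ) : Option (Fin (N ^ 2 - 1)) → Matrix (Fin N) (Fin N) ℂ
  | none => 1
  | some i => G.θ i

/-- Taking the trace of a relation isolates the coefficient of `1`; multiplying by `θ_j` before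
taking it isolates that of `θ_j`. -/
theorem linearIndependent_extended (G : Generators N κ) (hN : 2 ≤ N) (hκ : κ ≠ 0) :
    LinearIndependent ℂ G.extended := by
  rw [Fintype.linearIndependent_iff]
  intro c hc
  rw [Fintype.sum_option] at hc
  simp only [extended] at hc
  have hN0 : (N : ℂ) ≠ 0 := by exact_mod_cast (by omega : N ≠ 0)
  rintro (_ | j)
  · have := congrArg Matrix.trace hc
    simpa [trace_sum, G.trace_eq_zero, hN0] using this
  · have := congrArg (fun A => (G.θ j * A).trace) hc
    simpa [mul_add, Finset.mul_sum, trace_sum, G.trace_eq_zero, G.trace_mul, hκ] using this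

/-- Completeness: the generators and the identity matrix form an orthogonal basis of the space of
all complex matrices. -/
theorem eq_sum_trace (G : Generators N κ) (hN : 2 ≤ N) (hκ : κ ≠ 0)
    (A : Matrix (Fin N) (Fin N) ℂ) :
    A = ((N : ℂ)⁻¹ * A.trace) • (1 : Matrix (Fin N) (Fin N) ℂ)
      + ∑ k, ((κ : ℂ)⁻¹ * (G.θ k * A).trace) • G.θ k := by
  have hN0 : (N : ℂ) ≠ 0 := by exact_mod_cast (by omega : N ≠ 0)
  have hκ' : (κ : ℂ) ≠ 0 := by exact_mod_cast hκ
  have hcard : Fintype.card (Option (Fin (N ^ 2 - 1)))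
      = Module.finrank ℂ (Matrix (Fin N) (Fin N) ℂ) := by
    have : 1 ≤ N ^ 2 := Nat.one_le_pow _ _ (by omega)
    simp [Module.finrank_matrix]
    rw [← sq]; omega
  have hspan := (G.linearIndependent_extended hN hκ).span_eq_top_of_card_eq_finrank' hcard
  have hA : A ∈ Submodule.span ℂ (Set.range G.extended) := hspan ▸ Submodule.mem_top
  obtain ⟨c, rfl⟩ := (Submodule.mem_span_range_iff_exists_fun ℂ).1 hA
  rw [Fintype.sum_option]
  simp only [extended]
  congr 1
  · congr 1
    simp [trace_sum, G.trace_eq_zero]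
    field_simp
  · refine Finset.sum_congr rfl fun k _ => ?_
    congr 1
    simp [mul_add, Finset.mul_sum, trace_sum, G.trace_eq_zero, G.trace_mul]
    field_simp

theorem eq_sum_trace_of_trace_eq_zero (G : Generators N κ) (hN : 2 ≤ N) (hκ : κ ≠ 0)
    {A : Matrix (Fin N) (Fin N) ℂ} (hA : A.trace = 0) :
    A = ∑ k, ((κ : ℂ)⁻¹ * (G.θ k * A).trace) • G.θ k := by
  conv_lhs => rw [G.eq_sum_trace hN hκ A]
  simp [hA]

/-- Parseval's identity for the trace form. -/
theorem sum_trace_mul_trace (G : Generators N κ) (hN : 2 ≤ N) (hκ : κ ≠ 0)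
    {A B : Matrix (Fin N) (Fin N) ℂ} (hA : A.trace = 0) :
    ∑ k, (A * G.θ k).trace * (B * G.θ k).trace = κ * (A * B).trace := by
  have hκ' : (κ : ℂ) ≠ 0 := by exact_mod_cast hκ
  conv_rhs => rw [G.eq_sum_trace_of_trace_eq_zero hN hκ hA]
  rw [Finset.sum_mul, trace_sum, Finset.mul_sum]
  refine Finset.sum_congr rfl fun k _ => ?_
  rw [smul_mul_assoc, trace_smul, smul_eq_mul, trace_mul_comm A, trace_mul_comm B]
  field_simp

/-- The Fierz identity. -/
theorem fierz (G : Generators N κ) (hN : 2 ≤ N) (hκ : κ ≠ 0) (a b c d : Fin N) :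
    ∑ k, G.θ k b a * G.θ k c d
      = κ * ((if a = c then if b = d then 1 else 0 else 0)
        - (N : ℂ)⁻¹ * (if a = b then if c = d then 1 else 0 else 0)) := by
  have hκ' : (κ : ℂ) ≠ 0 := by exact_mod_cast hκ
  have h := congrFun (congrFun (G.eq_sum_trace hN hκ (single a b 1)) c) d
  have htr : ∀ k, (G.θ k * single a b 1).trace = G.θ k b a := by
    intro k
    simp [trace_mul_single]
  have htr1 : (single a b (1 : ℂ)).trace = if a = b then 1 else 0 := by
    split_ifs with hab
    · subst hab; simp
    · exact trace_single_eq_of_ne a b 1 hab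
  simp only [Matrix.add_apply, Matrix.smul_apply, Matrix.sum_apply, htr, htr1, smul_eq_mul,
    one_apply, mul_assoc, ← Finset.mul_sum] at h
  rw [single_apply] at h
  have h2 : ∑ k, G.θ k b a * G.θ k c d = κ * ((if a = c ∧ b = d then 1 else 0) -
      ((N : ℂ)⁻¹ * ((if a = b then 1 else 0) * if c = d then 1 else 0))) := by
    rw [h]; field_simp; ring
  rw [h2, ite_and, ite_zero_mul, one_mul]

/-- The Fierz identity contracted with `A`. The Casimir computation uses it for `A = 1` and `A =
θ_j`. -/
theorem sum_θ_mul_mul_θ (G : Generators N κ) (hN : 2 ≤ N) (hκ : κ ≠ 0)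
    (A : Matrix (Fin N) (Fin N) ℂ) :
    ∑ k, G.θ k * A * G.θ k = (κ * A.trace) • (1 : Matrix (Fin N) (Fin N) ℂ)
      - ((κ : ℂ) * (N : ℂ)⁻¹) • A := by
  ext p q
  simp only [Matrix.sum_apply, mul_apply, Finset.sum_mul]
  rw [Finset.sum_comm]
  have : ∀ y : Fin N, ∑ k, ∑ x, G.θ k p x * A x y * G.θ k y q
      = ∑ x, A x y * ∑ k, G.θ k p x * G.θ k y q := by
    intro y
    rw [Finset.sum_comm]
    refine Finset.sum_congr rfl fun x _ => ?_
    rw [Finset.mul_sum]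
    exact Finset.sum_congr rfl fun k _ => by ring
  simp only [this, G.fierz hN hκ, mul_sub, Finset.sum_sub_distrib]
  simp [Matrix.trace, one_apply, Finset.mul_sum]
  split_ifs <;> simp [mul_comm]

/-- The commutator of self-adjoint matrices is anti-self-adjoint, so this trace is purely imaginary
and nothing is lost in the imaginary part that defines `f`. -/
theorem trace_commutator_mul (G : Generators N κ) (hκ : 0 < κ) (i j k : Fin (N ^ 2 - 1)) :
    ((G.θ i * G.θ j - G.θ j * G.θ i) * G.θ k).trace
      = Complex.I * (κ * (√(2 * κ) : ℝ)) * G.f i j k := by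
  set z := ((G.θ i * G.θ j - G.θ j * G.θ i) * G.θ k).trace with hz
  have hre : z.re = 0 := by
    have h : star z = -z := by
      rw [hz, ← trace_conjTranspose]
      simp only [conjTranspose_mul, conjTranspose_sub, (G.isHermitian _).eq]
      rw [trace_mul_comm, ← trace_neg, ← neg_mul, neg_sub]
    have := congrArg Complex.re h
    simp at this
    linarith
  have hs : (√(2 * κ) : ℝ) ≠ 0 := (Real.sqrt_pos.2 (by positivity)).ne'
  have him : z.im = κ * √(2 * κ) * G.f i j k := by
    rw [f, ← hz]
    field_simp
  apply Complex.ext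
  · simp [hre]
  · simp [him]

theorem commutator_eq (G : Generators N κ) (hN : 2 ≤ N) (hκ : 0 < κ) (i j : Fin (N ^ 2 - 1)) :
    G.θ i * G.θ j - G.θ j * G.θ i
      = (Complex.I * (√(2 * κ) : ℝ)) • ∑ k, (G.f i j k : ℂ) • G.θ k := by
  have hκ' : (κ : ℂ) ≠ 0 := by exact_mod_cast hκ.ne'
  have htr : (G.θ i * G.θ j - G.θ j * G.θ i).trace = 0 := by
    rw [trace_sub, trace_mul_comm, sub_self]
  conv_lhs => rw [G.eq_sum_trace_of_trace_eq_zero hN hκ.ne' htr]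
  rw [Finset.smul_sum]
  refine Finset.sum_congr rfl fun k _ => ?_
  rw [smul_smul, trace_mul_comm, G.trace_commutator_mul hκ]
  congr 1
  field_simp

theorem f_swap_left (G : Generators N κ) (i j k : Fin (N ^ 2 - 1)) :
    G.f i j k = -G.f j i k := by
  rw [f, f, ← mul_neg, ← Complex.neg_im, ← trace_neg, ← neg_mul, neg_sub]

theorem f_swap_right (G : Generators N κ) (i j k : Fin (N ^ 2 - 1)) :
    G.f i j k = -G.f i k j := by
  rw [f, f, ← mul_neg, ← Complex.neg_im, ← trace_neg, ← neg_mul, neg_sub]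
  congr 2
  rw [sub_mul, sub_mul, trace_sub, trace_sub]
  congr 1
  · rw [trace_mul_comm, mul_assoc]
  · rw [mul_assoc, trace_mul_comm, mul_assoc]

/-- Parseval turns the sum over `l` into the trace of a product of two commutators. Expanding that
product leaves sums over `k` of the form `θ_k A θ_k`, which the contracted Fierz identity evaluates.
-/
theorem casimir_eq (G : Generators N κ) (hN : 2 ≤ N) (hκ : 0 < κ) :
    G.casimir = (N : ℝ) • (1 : Matrix (Fin (N ^ 2 - 1)) (Fin (N ^ 2 - 1)) ℝ) := by
  have hκ' : (κ : ℂ) ≠ 0 := by exact_mod_cast hκ.ne'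
  have hN0 : (N : ℂ) ≠ 0 := by exact_mod_cast (by omega : N ≠ 0)
  have hs : ((√(2 * κ) : ℝ) : ℂ) ^ 2 = 2 * κ := by
    rw [← Complex.ofReal_pow, Real.sq_sqrt (by positivity)]
    push_cast; rfl
  ext i j
  rw [← Complex.ofReal_inj]
  -- The factor is `(i κ √(2κ))² = -2κ³`, one normalization factor from each structure constant.
  have hff : ∀ k l, -(2 * (κ : ℂ) ^ 3) * (G.f i k l * G.f j k l)
      = ((G.θ i * G.θ k - G.θ k * G.θ i) * G.θ l).trace *
        ((G.θ j * G.θ k - G.θ k * G.θ j) * G.θ l).trace := by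
    intro k l
    rw [G.trace_commutator_mul hκ, G.trace_commutator_mul hκ]
    linear_combination (κ ^ 2 * G.f i k l * G.f j k l : ℂ) * hs
      - ((κ ^ 2 * G.f i k l * G.f j k l : ℂ) * ((√(2 * κ) : ℝ) : ℂ) ^ 2) * Complex.I_sq
  have htr : ∀ k, (G.θ i * G.θ k - G.θ k * G.θ i).trace = 0 := fun k => by
    rw [trace_sub, trace_mul_comm, sub_self]
  have hsq : ∑ k, G.θ k * G.θ k
      = ((κ : ℂ) * N - κ * (N : ℂ)⁻¹) • (1 : Matrix (Fin N) (Fin N) ℂ) := by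
    have := G.sum_θ_mul_mul_θ hN hκ.ne' 1
    simp only [mul_one, trace_one, Fintype.card_fin] at this
    rw [this, sub_smul]
  have hj : ∑ k, G.θ k * G.θ j * G.θ k = -((κ : ℂ) * (N : ℂ)⁻¹) • G.θ j := by
    have := G.sum_θ_mul_mul_θ hN hκ.ne' (G.θ j)
    rw [this, G.trace_eq_zero]
    simp
  have hsum : ∑ k, ((G.θ i * G.θ k - G.θ k * G.θ i) * (G.θ j * G.θ k - G.θ k * G.θ j)).trace
      = -(2 * κ * N) * (G.θ i * G.θ j).trace := by
    have h1 : ∀ k, ((G.θ i * G.θ k - G.θ k * G.θ i) * (G.θ j * G.θ k - G.θ k * G.θ j)).trace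
        = (G.θ i * (G.θ k * G.θ j * G.θ k)).trace - (G.θ i * (G.θ k * G.θ k) * G.θ j).trace
          - ((G.θ i * G.θ j) * (G.θ k * G.θ k)).trace
          + (G.θ i * (G.θ k * G.θ j * G.θ k)).trace := by
      intro k
      have e1 : (G.θ k * G.θ i * (G.θ j * G.θ k)).trace
          = ((G.θ i * G.θ j) * (G.θ k * G.θ k)).trace := by
        rw [mul_assoc, trace_mul_comm]; simp only [mul_assoc]
      have e2 : (G.θ k * G.θ i * (G.θ k * G.θ j)).trace
          = (G.θ i * (G.θ k * G.θ j * G.θ k)).trace := by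
        rw [mul_assoc, trace_mul_comm]; simp only [mul_assoc]
      rw [sub_mul, mul_sub, mul_sub, trace_sub, trace_sub, trace_sub, e1, e2]
      simp only [mul_assoc]
      ring
    simp only [h1, Finset.sum_add_distrib, Finset.sum_sub_distrib, ← trace_sum, ← Finset.mul_sum,
      ← Finset.sum_mul, hsq, hj, mul_smul_comm, smul_mul_assoc, mul_one, trace_smul, smul_eq_mul]
    ring
  have key : -(2 * (κ : ℂ) ^ 3) * ∑ k, ∑ l, (G.f i k l * G.f j k l : ℂ)
      = -(2 * κ ^ 2 * N) * (G.θ i * G.θ j).trace := by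
    simp only [Finset.mul_sum, hff, G.sum_trace_mul_trace hN hκ.ne' (htr _)]
    rw [← Finset.mul_sum, hsum]
    ring
  rw [G.trace_mul] at key
  simp only [casimir, of_apply, Complex.ofReal_sum, Complex.ofReal_mul, Matrix.smul_apply,
    one_apply, smul_eq_mul]
  have h3 : -(2 * (κ : ℂ) ^ 3) ≠ 0 := by
    simp [hκ']
  apply mul_left_cancel₀ h3
  rw [key]
  split_ifs <;> push_cast <;> ring

end Generators

/-! ### Linear coordinates on the Lie algebra and first properties of `U`. -/

namespace Generators

variable {N : ℕ} {κ : ℝ}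

/-- The component map `A ↦ (κ⁻¹ Im tr (θ_j A))_j`, which inverts `b ↦ i b · θ`. -/
def coord (G : Generators N κ) : Matrix (Fin N) (Fin N) ℂ →ₗ[ℝ] GluonSpace N where
  toFun A := WithLp.toLp 2 fun j => κ⁻¹ * ((G.θ j * A).trace).im
  map_add' A B := by
    ext j
    simp [mul_add, trace_add]
  map_smul' t A := by
    ext j
    simp [trace_smul]
    ring

theorem coord_apply (G : Generators N κ) (A : Matrix (Fin N) (Fin N) ℂ) (j : Fin (N ^ 2 - 1)) :
    G.coord A j = κ⁻¹ * ((G.θ j * A).trace).im := rfl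

theorem coord_I_smul_dot (G : Generators N κ) (hκ : κ ≠ 0) (b : GluonSpace N) :
    G.coord (Complex.I • G.dot b) = b := by
  ext j
  rw [coord_apply, mul_smul_comm, trace_smul, trace_mul_dot]
  simp [hκ]

theorem I_smul_dot_coord (G : Generators N κ) (hN : 2 ≤ N) (hκ : κ ≠ 0)
    {A : Matrix (Fin N) (Fin N) ℂ} (hA : Aᴴ = -A) (ht : A.trace = 0) :
    Complex.I • G.dot (G.coord A) = A := by
  conv_rhs => rw [G.eq_sum_trace_of_trace_eq_zero hN hκ ht]
  rw [dot, Finset.smul_sum]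
  refine Finset.sum_congr rfl fun k _ => ?_
  rw [smul_smul, coord_apply]
  congr 1
  have hre : ((G.θ k * A).trace).re = 0 := by
    have h : star (G.θ k * A).trace = -(G.θ k * A).trace := by
      rw [← trace_conjTranspose, conjTranspose_mul, hA, (G.isHermitian k).eq, neg_mul, trace_neg,
        trace_mul_comm]
    have := congrArg Complex.re h
    simp at this
    linarith
  apply Complex.ext <;> simp [hre]

/-- `b ↦ i b · θ` as a linear map. -/
def dotI (G : Generators N κ) : GluonSpace N →ₗ[ℝ] Matrix (Fin N) (Fin N) ℂ where
  toFun b := Complex.I • G.dot b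
  map_add' a b := by rw [dot_add, smul_add]
  map_smul' t b := by rw [dot_smul, smul_comm]; rfl

theorem dotI_apply (G : Generators N κ) (b : GluonSpace N) : G.dotI b = Complex.I • G.dot b := rfl

theorem coord_dotI (G : Generators N κ) (hκ : κ ≠ 0) (b : GluonSpace N) :
    G.coord (G.dotI b) = b := G.coord_I_smul_dot hκ b

theorem dotI_coord (G : Generators N κ) (hN : 2 ≤ N) (hκ : κ ≠ 0)
    {A : Matrix (Fin N) (Fin N) ℂ} (hA : Aᴴ = -A) (ht : A.trace = 0) :
    G.dotI (G.coord A) = A := G.I_smul_dot_coord hN hκ hA ht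

theorem conjTranspose_dotI (G : Generators N κ) (b : GluonSpace N) :
    (G.dotI b)ᴴ = -G.dotI b := by
  simp [dotI_apply, conjTranspose_smul, (G.dot_isHermitian b).eq]

theorem trace_dotI (G : Generators N κ) (b : GluonSpace N) : (G.dotI b).trace = 0 := by
  simp [dotI_apply, trace_smul, G.dot_trace]

theorem coe_U (G : Generators N κ) (b : GluonSpace N) :
    (G.U b : Matrix (Fin N) (Fin N) ℂ) = NormedSpace.exp (G.dotI b) := rfl

theorem U_zero (G : Generators N κ) : G.U 0 = 1 := by
  apply Subtype.ext
  rw [coe_U, map_zero, NormedSpace.exp_zero]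
  rfl

theorem U_two_smul (G : Generators N κ) (b : GluonSpace N) : G.U ((2 : ℝ) • b) = G.U b * G.U b := by
  apply Subtype.ext
  rw [Submonoid.coe_mul, coe_U, coe_U, two_smul, map_add,
    Matrix.exp_add_of_commute _ _ (Commute.refl _)]

theorem U_neg (G : Generators N κ) (b : GluonSpace N) : G.U (-b) = (G.U b)⁻¹ := by
  rw [eq_inv_iff_mul_eq_one]
  apply Subtype.ext
  rw [Submonoid.coe_mul, coe_U, coe_U, map_neg,
    ← Matrix.exp_add_of_commute _ _ (Commute.refl (G.dotI b)).neg_left]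
  simp

end Generators

/-! ### The local logarithm on `SU(N)`. -/

section Norm

attribute [local instance] Matrix.linftyOpNormedRing Matrix.linftyOpNormedAlgebra

/-- The local inverse of the matrix exponential at `1`. -/
theorem exists_matrix_log (N : ℕ) :
    ∃ e : OpenPartialHomeomorph (Matrix (Fin N) (Fin N) ℂ) (Matrix (Fin N) (Fin N) ℂ),
      (∀ X, e X = NormedSpace.exp X) ∧ 0 ∈ e.source ∧ 1 ∈ e.target ∧ e.symm 1 = 0 ∧
        AnalyticAt ℝ e.symm 1 := by
  have h0 : HasStrictFDerivAt (NormedSpace.exp : Matrix (Fin N) (Fin N) ℂ → _)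
      ((ContinuousLinearEquiv.refl ℝ (Matrix (Fin N) (Fin N) ℂ) :
        Matrix (Fin N) (Fin N) ℂ ≃L[ℝ] Matrix (Fin N) (Fin N) ℂ) :
        Matrix (Fin N) (Fin N) ℂ →L[ℝ] Matrix (Fin N) (Fin N) ℂ) 0 :=
    hasStrictFDerivAt_exp_zero (𝕂 := ℝ)
  let e := h0.toOpenPartialHomeomorph NormedSpace.exp
  have he : (e : Matrix (Fin N) (Fin N) ℂ → _) = NormedSpace.exp := rfl
  have hs : (0 : Matrix (Fin N) (Fin N) ℂ) ∈ e.source := h0.mem_toOpenPartialHomeomorph_source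
  have he0 : e 0 = 1 := by rw [he, NormedSpace.exp_zero]
  have ht : (1 : Matrix (Fin N) (Fin N) ℂ) ∈ e.target := he0 ▸ e.map_source hs
  have hsymm : e.symm 1 = 0 := by rw [← he0, e.left_inv hs]
  refine ⟨e, fun _ => rfl, hs, ht, hsymm, ?_⟩
  refine e.analyticAt_symm (i := ContinuousLinearEquiv.refl ℝ _) ht ?_ ?_
  · rw [he]
    exact NormedSpace.exp_analytic (𝕂 := ℝ) _
  · rw [hsymm, he]
    exact h0.hasFDerivAt.fderiv

/-- Split `X` into the scalar matrix with the same trace and a traceless rest. The two commute, and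
the exponential of the rest is special unitary by `exp_I_smul_mem`. -/
theorem det_exp_of_conjTranspose_eq_neg {N : ℕ} (hN : N ≠ 0) {X : Matrix (Fin N) (Fin N) ℂ}
    (hX : Xᴴ = -X) : (NormedSpace.exp X).det = Complex.exp X.trace := by
  have hN0 : (N : ℂ) ≠ 0 := by exact_mod_cast hN
  set c : ℂ := (N : ℂ)⁻¹ * X.trace with hc
  have htr : star X.trace = -X.trace := by rw [← trace_conjTranspose, hX, trace_neg]
  have hcs : star c = -c := by
    rw [hc, star_mul', htr]
    simp
  set H : Matrix (Fin N) (Fin N) ℂ := -Complex.I • (X - c • 1) with hH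
  have hIH : Complex.I • H = X - c • 1 := by
    rw [hH, smul_smul]; simp
  have hherm : H.IsHermitian := by
    have h1 : (X - c • 1)ᴴ = -(X - c • 1) := by
      rw [conjTranspose_sub, hX, conjTranspose_smul, hcs, conjTranspose_one, neg_smul]
      abel
    rw [Matrix.IsHermitian, hH, conjTranspose_smul, h1, smul_neg, ← neg_smul]
    simp
  have htrace : H.trace = 0 := by
    rw [hH, trace_smul, trace_sub, trace_smul, trace_one, hc]
    simp only [Fintype.card_fin, smul_eq_mul]
    field_simp
    ring
  have hdet : (NormedSpace.exp (X - c • 1)).det = 1 := by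
    have := (exp_I_smul_mem hherm htrace).2
    rw [hIH] at this
    exact this
  have hX' : X = c • 1 + (X - c • 1) := by abel
  have hcomm : Commute (c • (1 : Matrix (Fin N) (Fin N) ℂ)) (X - c • 1) :=
    (Commute.one_left _).smul_left c
  rw [hX', Matrix.exp_add_of_commute _ _ hcomm, det_mul, hdet, mul_one, ← hX', smul_one_eq_diagonal,
    exp_diagonal, det_diagonal]
  have : ∀ i, (NormedSpace.exp fun _ : Fin N => c) i = Complex.exp c := by
    intro i
    rw [Pi.coe_exp, Complex.exp_eq_exp_ℂ]
  rw [Finset.prod_congr rfl fun i _ => this i, ← Complex.exp_sum, Finset.sum_const]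
  congr 1
  simp [hc, hN0]

namespace Generators

variable {N : ℕ} {κ : ℝ}

/-- `b ↦ i b · θ` as a continuous linear map. -/
def dotICLM (G : Generators N κ) : GluonSpace N →L[ℝ] Matrix (Fin N) (Fin N) ℂ :=
  LinearMap.toContinuousLinearMap G.dotI

theorem analyticAt_coe_U (G : Generators N κ) (b : GluonSpace N) :
    AnalyticAt ℝ (fun b => (G.U b : Matrix (Fin N) (Fin N) ℂ)) b :=
  AnalyticAt.comp (g := NormedSpace.exp) (f := G.dotICLM)
    (NormedSpace.exp_analytic (𝕂 := ℝ) _) (G.dotICLM.analyticAt b)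

theorem hasFDerivAt_coe_U_zero (G : Generators N κ) :
    HasFDerivAt (fun b => (G.U b : Matrix (Fin N) (Fin N) ℂ)) G.dotICLM 0 := by
  have h : HasFDerivAt (NormedSpace.exp : Matrix (Fin N) (Fin N) ℂ → _)
      (1 : Matrix (Fin N) (Fin N) ℂ →L[ℝ] Matrix (Fin N) (Fin N) ℂ) (G.dotICLM 0) := by
    rw [map_zero]
    exact hasFDerivAt_exp_zero
  exact h.comp (0 : GluonSpace N) G.dotICLM.hasFDerivAt

theorem continuous_U (G : Generators N κ) : Continuous G.U :=
  continuous_induced_rng.2 (continuous_iff_continuousAt.2 fun b =>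
    (G.analyticAt_coe_U b).continuousAt)

/-- The logarithm provides gluon coordinates near the identity. -/
theorem exists_log (G : Generators N κ) (hN : 2 ≤ N) (hκ : κ ≠ 0) :
    ∃ L : Matrix (Fin N) (Fin N) ℂ → GluonSpace N, AnalyticAt ℝ L 1 ∧
      (∀ᶠ b in 𝓝 (0 : GluonSpace N), L (G.U b) = b) ∧
      ∀ᶠ u : specialUnitaryGroup (Fin N) ℂ in 𝓝 1, G.U (L u) = u := by
  obtain ⟨e, he, hs, ht, hsymm, han⟩ := exists_matrix_log N
  let coordL : Matrix (Fin N) (Fin N) ℂ →L[ℝ] GluonSpace N :=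
    LinearMap.toContinuousLinearMap G.coord
  refine ⟨fun u => coordL (e.symm u), (coordL.analyticAt _).comp han, ?_, ?_⟩
  · have hc : Tendsto G.dotICLM (𝓝 0) (𝓝 0) := by
      simpa using G.dotICLM.continuous.tendsto 0
    filter_upwards [hc.eventually (e.open_source.mem_nhds hs)] with b hb
    rw [coe_U, ← he]
    change G.coord (e.symm (e (G.dotICLM b))) = b
    rw [e.left_inv hb]
    exact G.coord_dotI hκ b
  · have hlog : Tendsto (fun u : specialUnitaryGroup (Fin N) ℂ =>
        e.symm (u : Matrix (Fin N) (Fin N) ℂ)) (𝓝 1) (𝓝 0) := by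
      have h1 : Tendsto e.symm (𝓝 (1 : Matrix (Fin N) (Fin N) ℂ)) (𝓝 0) := by
        have := han.continuousAt.tendsto
        rwa [hsymm] at this
      exact h1.comp (continuous_subtype_val.tendsto (1 : specialUnitaryGroup (Fin N) ℂ))
    have hstar : Tendsto (fun X : Matrix (Fin N) (Fin N) ℂ => -Xᴴ) (𝓝 0) (𝓝 0) := by
      have : Continuous (fun X : Matrix (Fin N) (Fin N) ℂ => -Xᴴ) := by fun_prop
      simpa using this.tendsto 0
    have htr : Tendsto (fun X : Matrix (Fin N) (Fin N) ℂ => ‖X.trace‖) (𝓝 0) (𝓝 0) := by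
      have : Continuous (fun X : Matrix (Fin N) (Fin N) ℂ => ‖X.trace‖) := by fun_prop
      simpa using this.tendsto 0
    have hsrc := e.open_source.mem_nhds hs
    have htgt : ∀ᶠ u : specialUnitaryGroup (Fin N) ℂ in 𝓝 1,
        (u : Matrix (Fin N) (Fin N) ℂ) ∈ e.target :=
      (continuous_subtype_val.tendsto (1 : specialUnitaryGroup (Fin N) ℂ)).eventually
        (e.open_target.mem_nhds ht)
    have hlog₂ := hstar.comp hlog
    have hlog₃ := htr.comp hlog
    filter_upwards [htgt, hlog.eventually hsrc, hlog₂.eventually hsrc,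
      hlog₃.eventually (gt_mem_nhds Real.two_pi_pos)] with u hu h1 h2 h3
    simp only [Function.comp_apply] at h2 h3
    set X := e.symm (u : Matrix (Fin N) (Fin N) ℂ) with hX
    have hexp : NormedSpace.exp X = u := by rw [← he, e.right_inv hu]
    -- Since `u⁻¹ = u*`, both `X` and `-Xᴴ` are logarithms of `u`; both lie in the source of the
    -- local inverse, where `exp` is injective.
    have hskew : -Xᴴ = X := by
      refine e.injOn h2 h1 ?_
      rw [he, he, hexp, Matrix.exp_neg, exp_conjTranspose, hexp, ← star_eq_conjTranspose]
      exact inv_eq_left_inv (mem_unitaryGroup_iff.1 u.2.1)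
    have hskew' : Xᴴ = -X := neg_eq_iff_eq_neg.1 hskew
    -- `det u = 1` gives `exp (tr X) = 1`, hence `tr X ∈ 2πiℤ`; the bound `‖tr X‖ < 2π` leaves only
    -- `0`.
    have htrX : X.trace = 0 := by
      have hdet := det_exp_of_conjTranspose_eq_neg (by omega : N ≠ 0) hskew'
      rw [hexp, (mem_specialUnitaryGroup_iff.1 u.2).2] at hdet
      obtain ⟨m, hm⟩ := Complex.exp_eq_one_iff.1 hdet.symm
      rw [hm] at h3 ⊢
      have : |(m : ℝ)| < 1 := by
        simp [abs_of_pos Real.pi_pos] at h3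
        nlinarith [Real.pi_pos]
      have hm0 : m = 0 := by
        rw [← Int.abs_lt_one_iff]
        exact_mod_cast this
      simp [hm0]
    apply Subtype.ext
    rw [coe_U, ← hexp]
    congr 1
    exact G.dotI_coord hN hκ hskew' htrX

end Generators
end Norm

/-- The matrix of a linear map in the standard coordinates of `GluonSpace N`. -/
def coordMatrix {N : ℕ} (D : GluonSpace N →L[ℝ] GluonSpace N) :
    Matrix (Fin (N ^ 2 - 1)) (Fin (N ^ 2 - 1)) ℝ :=
  Matrix.of fun i j => D (EuclideanSpace.single j 1) i

theorem sum_smul_single {N : ℕ} (v : GluonSpace N) :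
    ∑ k, v k • EuclideanSpace.single k (1 : ℝ) = v := by
  ext j
  simp [Pi.single_apply]

theorem det_coordMatrix {N : ℕ} (D : GluonSpace N →L[ℝ] GluonSpace N) :
    (coordMatrix D).det = D.det := by
  have : coordMatrix D = LinearMap.toMatrix (EuclideanSpace.basisFun (Fin (N ^ 2 - 1)) ℝ).toBasis
      (EuclideanSpace.basisFun (Fin (N ^ 2 - 1)) ℝ).toBasis (D : GluonSpace N →ₗ[ℝ] GluonSpace N) := by
    ext i j
    simp [coordMatrix, LinearMap.toMatrix_apply]
  rw [this, LinearMap.det_toMatrix]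

/-! ### The Maurer-Cartan form: left invariance, values in the Lie algebra, doubling. -/

section Norm

attribute [local instance] Matrix.linftyOpNormedRing Matrix.linftyOpNormedAlgebra

namespace Generators

variable {N : ℕ} {κ : ℝ}

/-- The definition differentiates entry by entry and so depends on no matrix norm. With the
auxiliary norm chosen here the whole matrix can be differentiated at once. -/
theorem maurerCartan_eq (G : Generators N κ) (b v : GluonSpace N) :
    G.maurerCartan b v = (((G.U b)⁻¹ : specialUnitaryGroup (Fin N) ℂ) : Matrix (Fin N) (Fin N) ℂ)
      * fderiv ℝ (fun b' => (G.U b' : Matrix (Fin N) (Fin N) ℂ)) b v := by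
  rw [maurerCartan]
  congr 1
  ext p q
  rw [of_apply]
  let entry : Matrix (Fin N) (Fin N) ℂ →L[ℝ] ℂ :=
    LinearMap.toContinuousLinearMap (Matrix.entryLinearMap ℝ ℂ p q)
  have h := entry.hasFDerivAt.comp b (G.analyticAt_coe_U b).differentiableAt.hasFDerivAt
  exact congrArg (fun D : GluonSpace N →L[ℝ] ℂ => D v) h.fderiv

theorem inv_mul_coe (u : specialUnitaryGroup (Fin N) ℂ) :
    ((u⁻¹ : specialUnitaryGroup (Fin N) ℂ) : Matrix (Fin N) (Fin N) ℂ) * u = 1 := by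
  rw [← Submonoid.coe_mul, inv_mul_cancel]; rfl

theorem mul_inv_coe (u : specialUnitaryGroup (Fin N) ℂ) :
    (u : Matrix (Fin N) (Fin N) ℂ) * ((u⁻¹ : specialUnitaryGroup (Fin N) ℂ)) = 1 := by
  rw [← Submonoid.coe_mul, mul_inv_cancel]; rfl

theorem fderiv_coe_U (G : Generators N κ) (b v : GluonSpace N) :
    fderiv ℝ (fun b' => (G.U b' : Matrix (Fin N) (Fin N) ℂ)) b v
      = (G.U b : Matrix (Fin N) (Fin N) ℂ) * G.maurerCartan b v := by
  rw [maurerCartan_eq, ← mul_assoc, mul_inv_coe, one_mul]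

theorem maurerCartan_add (G : Generators N κ) (b v v' : GluonSpace N) :
    G.maurerCartan b (v + v') = G.maurerCartan b v + G.maurerCartan b v' := by
  simp only [maurerCartan_eq, map_add, mul_add]

theorem maurerCartan_smul (G : Generators N κ) (b : GluonSpace N) (t : ℝ) (v : GluonSpace N) :
    G.maurerCartan b (t • v) = t • G.maurerCartan b v := by
  simp only [maurerCartan_eq, map_smul, mul_smul_comm]

theorem maurerCartan_zero (G : Generators N κ) (v : GluonSpace N) :
    G.maurerCartan 0 v = G.dotI v := by
  rw [maurerCartan_eq, G.hasFDerivAt_coe_U_zero.fderiv, U_zero, inv_one]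
  exact one_mul _

/-- The Maurer-Cartan form is invariant under left translations. -/
theorem maurerCartan_pullback (G : Generators N κ) {b : GluonSpace N}
    {ψ : GluonSpace N → GluonSpace N} {D : GluonSpace N →L[ℝ] GluonSpace N}
    (hψ : HasFDerivAt ψ D b) {g : specialUnitaryGroup (Fin N) ℂ}
    (h : ∀ᶠ b' in 𝓝 b, G.U (ψ b') = g * G.U b') (v : GluonSpace N) :
    G.maurerCartan (ψ b) (D v) = G.maurerCartan b v := by
  have h1 := (G.analyticAt_coe_U (ψ b)).differentiableAt.hasFDerivAt.comp b hψ
  have h2 := (G.analyticAt_coe_U b).differentiableAt.hasFDerivAt.const_mul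
    (g : Matrix (Fin N) (Fin N) ℂ)
  have h3 : (fun b' => (g : Matrix (Fin N) (Fin N) ℂ) * G.U b') =ᶠ[𝓝 b]
      (fun b' => (G.U b' : Matrix (Fin N) (Fin N) ℂ)) ∘ ψ := by
    filter_upwards [h] with b' hb'
    simp [hb']
  have h4 := congrArg (fun E : GluonSpace N →L[ℝ] Matrix (Fin N) (Fin N) ℂ => E v)
    (h1.unique (h2.congr_of_eventuallyEq h3.symm))
  have h5 : fderiv ℝ (fun b' => (G.U b' : Matrix (Fin N) (Fin N) ℂ)) (ψ b) (D v)
      = (g : Matrix (Fin N) (Fin N) ℂ) *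
        fderiv ℝ (fun b' => (G.U b' : Matrix (Fin N) (Fin N) ℂ)) b v := h4
  rw [fderiv_coe_U, fderiv_coe_U, h.self_of_nhds, ← mul_assoc, Submonoid.coe_mul] at h5
  have h6 := congrArg (fun A => (((g * G.U b)⁻¹ : specialUnitaryGroup (Fin N) ℂ) :
    Matrix (Fin N) (Fin N) ℂ) * A) h5
  simp only [← mul_assoc] at h6
  rwa [mul_assoc _ (g : Matrix (Fin N) (Fin N) ℂ), ← Submonoid.coe_mul, inv_mul_coe, one_mul,
    one_mul] at h6

/-- The map `b' ↦ log (U(b)⁻¹ U(b'))` is a left translation in coordinates and sends `b` to `0`. By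
invariance the form at `b` equals a value of the form at `0`, where it is `dotI`. -/
theorem exists_maurerCartan_eq_dotI (G : Generators N κ) (hN : 2 ≤ N) (hκ : κ ≠ 0)
    (b v : GluonSpace N) : ∃ x, G.maurerCartan b v = G.dotI x := by
  obtain ⟨L, hL, hLU, hUL⟩ := G.exists_log hN hκ
  have hcancel : (((G.U b)⁻¹ : specialUnitaryGroup (Fin N) ℂ) : Matrix (Fin N) (Fin N) ℂ) * G.U b
      = 1 := inv_mul_coe _
  have hψ : HasFDerivAt (fun b' => L ((((G.U b)⁻¹ : specialUnitaryGroup (Fin N) ℂ) :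
      Matrix (Fin N) (Fin N) ℂ) * G.U b')) _ b :=
    ((hcancel ▸ hL.differentiableAt : DifferentiableAt ℝ L _).comp b
      ((G.analyticAt_coe_U b).differentiableAt.const_mul _)).hasFDerivAt
  have hev : ∀ᶠ b' in 𝓝 b, G.U (L ((((G.U b)⁻¹ : specialUnitaryGroup (Fin N) ℂ) :
      Matrix (Fin N) (Fin N) ℂ) * G.U b')) = (G.U b)⁻¹ * G.U b' := by
    have hc : Tendsto (fun b' => (G.U b)⁻¹ * G.U b') (𝓝 b) (𝓝 1) := by
      have : Continuous (fun b' => (G.U b)⁻¹ * G.U b') := G.continuous_U.const_mul _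
      simpa using this.tendsto b
    exact hc.eventually hUL
  have h := G.maurerCartan_pullback hψ hev v
  simp only [hcancel] at h
  have hL1 : L 1 = 0 := by simpa [U_zero] using hLU.self_of_nhds
  rw [hL1, maurerCartan_zero] at h
  exact ⟨_, h.symm⟩

theorem dotI_coord_maurerCartan (G : Generators N κ) (hN : 2 ≤ N) (hκ : κ ≠ 0)
    (b v : GluonSpace N) : G.dotI (G.coord (G.maurerCartan b v)) = G.maurerCartan b v := by
  obtain ⟨x, hx⟩ := G.exists_maurerCartan_eq_dotI hN hκ b v
  rw [hx, G.coord_dotI hκ]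

theorem coord_maurerCartan (G : Generators N κ) (b v : GluonSpace N) (j : Fin (N ^ 2 - 1)) :
    G.coord (G.maurerCartan b v) j = ∑ k, G.mcMatrix b j k * v k := by
  let T : GluonSpace N →ₗ[ℝ] GluonSpace N :=
    { toFun := fun v => G.coord (G.maurerCartan b v)
      map_add' := fun v v' => by rw [maurerCartan_add, map_add]
      map_smul' := fun t v => by rw [maurerCartan_smul, map_smul]; rfl }
  change T v j = _
  conv_lhs => rw [← sum_smul_single v]
  simp only [map_sum, map_smul, WithLp.ofLp_sum, Finset.sum_apply, PiLp.smul_apply, smul_eq_mul]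
  exact Finset.sum_congr rfl fun k _ => mul_comm _ _

theorem maurerCartan_eq_sum (G : Generators N κ) (hN : 2 ≤ N) (hκ : κ ≠ 0) (b v : GluonSpace N) :
    G.maurerCartan b v
      = Complex.I • ∑ j, ((∑ k, G.mcMatrix b j k * v k : ℝ) : ℂ) • G.θ j := by
  conv_lhs => rw [← G.dotI_coord_maurerCartan hN hκ b v, dotI_apply, dot]
  simp only [coord_maurerCartan]

theorem mcMatrix_pullback (G : Generators N κ) {b : GluonSpace N}
    {ψ : GluonSpace N → GluonSpace N} {D : GluonSpace N →L[ℝ] GluonSpace N}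
    (hψ : HasFDerivAt ψ D b) {g : specialUnitaryGroup (Fin N) ℂ}
    (h : ∀ᶠ b' in 𝓝 b, G.U (ψ b') = g * G.U b') :
    G.mcMatrix (ψ b) * coordMatrix D = G.mcMatrix b := by
  ext j k
  have h1 := congrArg (fun A => G.coord A j)
    (G.maurerCartan_pullback hψ h (EuclideanSpace.single k 1))
  simp only [coord_maurerCartan] at h1
  rw [mul_apply]
  simp only [coordMatrix, of_apply]
  rw [h1]
  simp

theorem mcMatrix_zero (G : Generators N κ) (hκ : κ ≠ 0) : G.mcMatrix 0 = 1 := by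
  ext j k
  have : G.mcMatrix 0 j k = G.coord (G.maurerCartan 0 (EuclideanSpace.single k 1)) j := rfl
  rw [this, maurerCartan_zero, G.coord_dotI hκ]
  simp [one_apply]

theorem analyticAt_mcMatrix (G : Generators N κ) (b : GluonSpace N) (j k : Fin (N ^ 2 - 1)) :
    AnalyticAt ℝ (fun b => G.mcMatrix b j k) b := by
  let F : Matrix (Fin N) (Fin N) ℂ →L[ℝ] ℝ := LinearMap.toContinuousLinearMap
    { toFun := fun A => κ⁻¹ * ((G.θ j * A).trace).im
      map_add' := fun A B => by simp [mul_add, trace_add]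
      map_smul' := fun t A => by simp [trace_smul]; ring }
  -- Writing `U(b)⁻¹` as `U(-b)` makes its analyticity immediate.
  have h1 : AnalyticAt ℝ (fun b => (G.U (-b) : Matrix (Fin N) (Fin N) ℂ)) b :=
    AnalyticAt.comp (f := fun b : GluonSpace N => -b) (G.analyticAt_coe_U (-b)) analyticAt_id.neg
  have h2 : AnalyticAt ℝ (fun b => fderiv ℝ (fun b' => (G.U b' : Matrix (Fin N) (Fin N) ℂ)) b
      (EuclideanSpace.single k 1)) b :=
    ((ContinuousLinearMap.apply ℝ (Matrix (Fin N) (Fin N) ℂ)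
      (EuclideanSpace.single k (1 : ℝ) : GluonSpace N)).analyticAt _).comp
      (G.analyticAt_coe_U b).fderiv
  have h3 := (F.analyticAt _).comp (h1.mul h2)
  refine h3.congr (Eventually.of_forall fun b' => ?_)
  simp only [mcMatrix, of_apply, maurerCartan_eq, ← U_neg]
  rfl

/-- The matrix of `X ↦ u⁻¹ X u` on the Lie algebra. -/
def adMatrix (G : Generators N κ) (u : specialUnitaryGroup (Fin N) ℂ) :
    Matrix (Fin (N ^ 2 - 1)) (Fin (N ^ 2 - 1)) ℝ :=
  Matrix.of fun j k => G.coord (((u⁻¹ : specialUnitaryGroup (Fin N) ℂ) : Matrix (Fin N) (Fin N) ℂ)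
    * G.dotI (EuclideanSpace.single k 1) * u) j

theorem coord_conj (G : Generators N κ) (u : specialUnitaryGroup (Fin N) ℂ) (x : GluonSpace N)
    (j : Fin (N ^ 2 - 1)) :
    G.coord (((u⁻¹ : specialUnitaryGroup (Fin N) ℂ) : Matrix (Fin N) (Fin N) ℂ) * G.dotI x * u) j
      = ∑ k, G.adMatrix u j k * x k := by
  conv_lhs => rw [← sum_smul_single x]
  simp only [map_sum, map_smul, Finset.mul_sum, Finset.sum_mul, mul_smul_comm, smul_mul_assoc,
    WithLp.ofLp_sum, Finset.sum_apply, PiLp.smul_apply, smul_eq_mul]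
  exact Finset.sum_congr rfl fun k _ => mul_comm _ _

theorem dotI_coord_conj (G : Generators N κ) (hN : 2 ≤ N) (hκ : κ ≠ 0)
    (u : specialUnitaryGroup (Fin N) ℂ) (x : GluonSpace N) :
    G.dotI (G.coord
      (((u⁻¹ : specialUnitaryGroup (Fin N) ℂ) : Matrix (Fin N) (Fin N) ℂ) * G.dotI x * u))
      = ((u⁻¹ : specialUnitaryGroup (Fin N) ℂ) : Matrix (Fin N) (Fin N) ℂ) * G.dotI x * u := by
  refine G.dotI_coord hN hκ ?_ ?_
  · have h1 : ((u⁻¹ : specialUnitaryGroup (Fin N) ℂ) : Matrix (Fin N) (Fin N) ℂ)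
        = (u : Matrix (Fin N) (Fin N) ℂ)ᴴ := rfl
    rw [h1, conjTranspose_mul, conjTranspose_mul, conjTranspose_conjTranspose, conjTranspose_dotI]
    simp [mul_assoc]
  · rw [mul_assoc, trace_mul_comm, mul_assoc, mul_inv_coe, mul_one, trace_dotI]

/-- The order is reversed because the action is `X ↦ u⁻¹ X u`. Only the case `u = v` is needed: `Ad`
at `2b` is the square of `Ad` at `b`. -/
theorem adMatrix_mul (G : Generators N κ) (hN : 2 ≤ N) (hκ : κ ≠ 0)
    (u v : specialUnitaryGroup (Fin N) ℂ) :
    G.adMatrix (u * v) = G.adMatrix v * G.adMatrix u := by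
  ext j k
  have h := G.coord_conj v (G.coord (((u⁻¹ : specialUnitaryGroup (Fin N) ℂ) :
    Matrix (Fin N) (Fin N) ℂ) * G.dotI (EuclideanSpace.single k 1) * u)) j
  rw [dotI_coord_conj G hN hκ] at h
  rw [mul_apply]
  refine Eq.trans ?_ h
  rw [adMatrix, of_apply, _root_.mul_inv_rev]
  simp only [Submonoid.coe_mul, mul_assoc]

/-- Differentiate `U(2b) = U(b)²` along `v` and multiply by `U(b)⁻²` from the left. -/
theorem maurerCartan_two_smul (G : Generators N κ) (b v : GluonSpace N) :
    G.maurerCartan ((2 : ℝ) • b) ((2 : ℝ) • v)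
      = (((G.U b)⁻¹ : specialUnitaryGroup (Fin N) ℂ) : Matrix (Fin N) (Fin N) ℂ)
        * G.maurerCartan b v * G.U b + G.maurerCartan b v := by
  have hline : HasDerivAt (fun t : ℝ => b + t • v) v 0 := by
    simpa using ((hasDerivAt_id (0 : ℝ)).smul_const v).const_add b
  have hline2 : HasDerivAt (fun t : ℝ => (2 : ℝ) • (b + t • v)) ((2 : ℝ) • v) 0 :=
    hline.const_smul (2 : ℝ)
  have e1 := (G.analyticAt_coe_U b).differentiableAt.hasFDerivAt
  have e2 := (G.analyticAt_coe_U ((2 : ℝ) • b)).differentiableAt.hasFDerivAt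
  have h1 := HasFDerivAt.comp_hasDerivAt_of_eq (0 : ℝ) e1 hline (by simp)
  have h2 := HasFDerivAt.comp_hasDerivAt_of_eq (0 : ℝ) e2 hline2 (by simp)
  have h3 := h1.mul h1
  have h4 : ((fun b' => (G.U b' : Matrix (Fin N) (Fin N) ℂ)) ∘ fun t : ℝ => (2 : ℝ) • (b + t • v))
      = ((fun b' => (G.U b' : Matrix (Fin N) (Fin N) ℂ)) ∘ fun t : ℝ => b + t • v) *
        ((fun b' => (G.U b' : Matrix (Fin N) (Fin N) ℂ)) ∘ fun t : ℝ => b + t • v) := by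
    funext t
    simp only [Function.comp_apply, Pi.mul_apply, U_two_smul, Submonoid.coe_mul]
  rw [h4] at h2
  have h5 : fderiv ℝ (fun b' => (G.U b' : Matrix (Fin N) (Fin N) ℂ)) ((2 : ℝ) • b) ((2 : ℝ) • v)
      = fderiv ℝ (fun b' => (G.U b' : Matrix (Fin N) (Fin N) ℂ)) b v * G.U b
        + G.U b * fderiv ℝ (fun b' => (G.U b' : Matrix (Fin N) (Fin N) ℂ)) b v := by
    have h := h2.unique h3
    simp only [Function.comp_apply, zero_smul, add_zero] at h
    exact h
  rw [fderiv_coe_U, fderiv_coe_U, U_two_smul, Submonoid.coe_mul] at h5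
  have h6 := congrArg (fun A => (((G.U b)⁻¹ : specialUnitaryGroup (Fin N) ℂ) :
    Matrix (Fin N) (Fin N) ℂ) * ((((G.U b)⁻¹ : specialUnitaryGroup (Fin N) ℂ) :
    Matrix (Fin N) (Fin N) ℂ) * A)) h5
  simp only [mul_add, ← mul_assoc, inv_mul_coe, one_mul] at h6
  exact h6

theorem mcMatrix_two_smul (G : Generators N κ) (hN : 2 ≤ N) (hκ : κ ≠ 0) (b : GluonSpace N) :
    (2 : ℝ) • G.mcMatrix ((2 : ℝ) • b) = (1 + G.adMatrix (G.U b)) * G.mcMatrix b := by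
  ext j k
  have h := congrArg (fun A => G.coord A j)
    (G.maurerCartan_two_smul b (EuclideanSpace.single k 1))
  simp only [maurerCartan_smul, map_smul, map_add, PiLp.add_apply, PiLp.smul_apply] at h
  rw [← G.dotI_coord_maurerCartan hN hκ b, coord_conj, G.coord_dotI hκ] at h
  rw [add_mul, one_mul, Matrix.add_apply, mul_apply, Matrix.smul_apply, add_comm]
  exact h

end Generators
end Norm

/-! ### Charts at the identity. -/

section Norm

attribute [local instance] Matrix.linftyOpNormedRing Matrix.linftyOpNormedAlgebra

namespace Generators

variable {N : ℕ} {κ : ℝ}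

/-- Gluon coordinates on an arbitrarily small neighbourhood of the identity. -/
theorem exists_chart (G : Generators N κ) (hN : 2 ≤ N) (hκ : κ ≠ 0) {S : Set (GluonSpace N)}
    (hS : S ∈ 𝓝 0) :
    ∃ (V : Set (GluonSpace N)) (L : specialUnitaryGroup (Fin N) ℂ → GluonSpace N),
      V ⊆ S ∧ IsOpen V ∧ 0 ∈ V ∧ (∀ b ∈ V, L (G.U b) = b) ∧ IsOpen (G.U '' V) ∧
      (∀ g : specialUnitaryGroup (Fin N) ℂ, ∀ b, g * G.U b ∈ G.U '' V →
        DifferentiableAt ℝ (fun b' => L (g * G.U b')) b) ∧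
      AnalyticAt ℝ (fun p : GluonSpace N × GluonSpace N => L (G.U p.2 * G.U p.1)) (0, 0) := by
  obtain ⟨L, hL, hLU, hUL⟩ := G.exists_log hN hκ
  set V₁ : Set (GluonSpace N) := interior S ∩ interior {b | L (G.U b) = b} with hV₁
  set T : Set (Matrix (Fin N) (Fin N) ℂ) := {A | AnalyticAt ℝ L A} with hT
  have hTo : IsOpen T := isOpen_analyticAt ℝ L
  set O₁ : Set (specialUnitaryGroup (Fin N) ℂ) :=
    interior {u | G.U (L u) = u} ∩ Subtype.val ⁻¹' T with hO₁
  have hO₁o : IsOpen O₁ := isOpen_interior.inter (hTo.preimage continuous_subtype_val)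
  have hV₁o : IsOpen V₁ := isOpen_interior.inter isOpen_interior
  have h0V₁ : 0 ∈ V₁ := ⟨mem_interior_iff_mem_nhds.2 hS, mem_interior_iff_mem_nhds.2 hLU⟩
  have h1O₁ : 1 ∈ O₁ := ⟨mem_interior_iff_mem_nhds.2 hUL, hL⟩
  have hLV : ∀ b ∈ V₁, L (G.U b) = b := fun b hb =>
    interior_subset (s := {b | L (G.U b) = b}) hb.2
  have hULO : ∀ u ∈ O₁, G.U (L u) = u := fun u hu =>
    interior_subset (s := {u : specialUnitaryGroup (Fin N) ℂ | G.U (L u) = u}) hu.1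
  -- This description makes the image open: `L` is continuous on the open set `O₁`, and `V₁` is
  -- open.
  have himage : G.U '' (V₁ ∩ G.U ⁻¹' O₁) = O₁ ∩ (fun u => L u) ⁻¹' V₁ := by
    ext u
    constructor
    · rintro ⟨b, ⟨hb, hbO⟩, rfl⟩
      refine ⟨hbO, ?_⟩
      simpa only [Set.mem_preimage, hLV b hb] using hb
    · rintro ⟨hu, huV⟩
      exact ⟨L u, ⟨huV, by simpa only [Set.mem_preimage, hULO u hu] using hu⟩, hULO u hu⟩
  have hcont : ContinuousOn (fun u : specialUnitaryGroup (Fin N) ℂ => L u) O₁ := fun u hu =>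
    (ContinuousAt.comp (f := Subtype.val) (AnalyticAt.continuousAt hu.2)
      continuous_subtype_val.continuousAt).continuousWithinAt
  refine ⟨V₁ ∩ G.U ⁻¹' O₁, fun u => L u, fun b hb => interior_subset hb.1.1,
    hV₁o.inter (hO₁o.preimage G.continuous_U), ⟨h0V₁, ?_⟩, fun b hb => hLV b hb.1, ?_, ?_, ?_⟩
  · rw [Set.mem_preimage, U_zero]; exact h1O₁
  · rw [himage]
    exact hcont.isOpen_inter_preimage hO₁o hV₁o
  · intro g b hgb
    rw [himage] at hgb
    have h1 : AnalyticAt ℝ L ((g : Matrix (Fin N) (Fin N) ℂ) * G.U b) := hgb.1.2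
    exact h1.differentiableAt.comp b
      ((G.analyticAt_coe_U b).differentiableAt.const_mul (g : Matrix (Fin N) (Fin N) ℂ))
  · have h1 : AnalyticAt ℝ (fun p : GluonSpace N × GluonSpace N =>
        (G.U p.2 : Matrix (Fin N) (Fin N) ℂ) * G.U p.1) (0, 0) :=
      AnalyticAt.mul
        (AnalyticAt.comp (g := fun b => (G.U b : Matrix (Fin N) (Fin N) ℂ))
          (f := fun p : GluonSpace N × GluonSpace N => p.2) (x := (0, 0))
          (G.analyticAt_coe_U 0) analyticAt_snd)
        (AnalyticAt.comp (g := fun b => (G.U b : Matrix (Fin N) (Fin N) ℂ))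
          (f := fun p : GluonSpace N × GluonSpace N => p.1) (x := (0, 0))
          (G.analyticAt_coe_U 0) analyticAt_fst)
    have h2 : (G.U (0 : GluonSpace N) : Matrix (Fin N) (Fin N) ℂ) * G.U (0 : GluonSpace N) = 1 := by
      rw [U_zero]; exact one_mul _
    exact AnalyticAt.comp (f := fun p : GluonSpace N × GluonSpace N =>
        (G.U p.2 : Matrix (Fin N) (Fin N) ℂ) * G.U p.1) (g := L) (by simpa only [h2] using hL) h1

end Generators

end Norm

/-! ### Positivity of `det W` and the local product. -/

theorem AnalyticAt.matrix_det {E n : Type*} [NormedAddCommGroup E] [NormedSpace ℝ E] [Fintype n]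
    [DecidableEq n] {A : E → Matrix n n ℝ} {x : E} (h : ∀ i j, AnalyticAt ℝ (fun y => A y i j) x) :
    AnalyticAt ℝ (fun y => (A y).det) x := by
  simp only [Matrix.det_apply']
  exact Finset.analyticAt_fun_sum _ fun σ _ =>
    analyticAt_const.mul (Finset.analyticAt_fun_prod _ fun i _ => h _ _)

/-- Over `ℂ` one has `1 + S² = (1 + iS)(1 - iS)`. For real `S` the two determinants are complex
conjugates, so their product is a squared modulus. -/
theorem Matrix.det_one_add_mul_self_nonneg {n : Type*} [Fintype n] [DecidableEq n]
    (S : Matrix n n ℝ) : 0 ≤ (1 + S * S).det := by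
  have h1 : ((1 + S * S).det : ℂ) = (1 + Complex.I • S.map Complex.ofRealHom).det
      * star (1 + Complex.I • S.map Complex.ofRealHom).det := by
    have h2 : star (1 + Complex.I • S.map Complex.ofRealHom).det
        = (1 - Complex.I • S.map Complex.ofRealHom).det := by
      change (starRingEnd ℂ) _ = _
      rw [RingHom.map_det]
      congr 1
      ext i j
      simp [one_apply, apply_ite (starRingEnd ℂ), sub_eq_add_neg]
    have h3 : (1 + S * S).map Complex.ofRealHom
        = (1 + Complex.I • S.map Complex.ofRealHom) * (1 - Complex.I • S.map Complex.ofRealHom) := by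
      rw [Matrix.map_add _ (map_add _), Matrix.map_mul, Matrix.map_one _ (map_zero _) (map_one _),
        add_mul, one_mul, mul_sub, mul_one, smul_mul_smul_comm, Complex.I_mul_I, neg_one_smul]
      abel
    have h4 : ((1 + S * S).det : ℂ) = ((1 + S * S).map Complex.ofRealHom).det :=
      RingHom.map_det Complex.ofRealHom _
    rw [h4, h2, h3, det_mul]
  have h5 : ((1 + S * S).det : ℂ) = (Complex.normSq (1 + Complex.I • S.map Complex.ofRealHom).det : ℂ) := by
    rw [h1, ← Complex.mul_conj]; rfl
  rw [Complex.ofReal_inj.1 h5]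
  exact Complex.normSq_nonneg _

namespace Generators

variable {N : ℕ} {κ : ℝ}

theorem analyticAt_det_mcMatrix (G : Generators N κ) (b : GluonSpace N) :
    AnalyticAt ℝ (fun b => (G.mcMatrix b).det) b :=
  AnalyticAt.matrix_det fun j k => G.analyticAt_mcMatrix b j k

theorem det_mcMatrix_zero (G : Generators N κ) (hκ : κ ≠ 0) : (G.mcMatrix 0).det = 1 := by
  rw [G.mcMatrix_zero hκ, det_one]

theorem continuous_det_mcMatrix (G : Generators N κ) : Continuous fun b => (G.mcMatrix b).det :=
  continuous_iff_continuousAt.2 fun b => (G.analyticAt_det_mcMatrix b).continuousAt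

theorem det_mcMatrix_two_smul (G : Generators N κ) (hN : 2 ≤ N) (hκ : κ ≠ 0) (b : GluonSpace N) :
    (G.mcMatrix ((2 : ℝ) • b)).det
      = ((2⁻¹ : ℝ) • (1 + G.adMatrix (G.U b))).det * (G.mcMatrix b).det := by
  rw [← det_mul, smul_mul_assoc, ← G.mcMatrix_two_smul hN hκ, smul_smul]
  norm_num

/-- Doubling preserves the sign of `det W`, because `Ad` at `b` is the square of `Ad` at `b/2`. Near
`0` the determinant is positive by continuity, and `2⁻ᵐ b` gets there. -/
theorem det_mcMatrix_nonneg (G : Generators N κ) (hN : 2 ≤ N) (hκ : κ ≠ 0) (b : GluonSpace N) :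
    0 ≤ (G.mcMatrix b).det := by
  have hstep : ∀ b : GluonSpace N, 0 ≤ (G.mcMatrix b).det → 0 ≤ (G.mcMatrix ((2 : ℝ) • b)).det := by
    intro b hb
    rw [G.det_mcMatrix_two_smul hN hκ]
    refine mul_nonneg ?_ hb
    have h2 : b = (2 : ℝ) • ((2⁻¹ : ℝ) • b) := by rw [smul_smul]; norm_num
    rw [det_smul, h2, U_two_smul, G.adMatrix_mul hN hκ]
    exact mul_nonneg (by positivity) (det_one_add_mul_self_nonneg _)
  have hlim : Tendsto (fun m : ℕ => (2⁻¹ : ℝ) ^ m • b) atTop (𝓝 0) := by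
    have := (tendsto_pow_atTop_nhds_zero_of_lt_one (r := (2⁻¹ : ℝ)) (by norm_num)
      (by norm_num)).smul_const b
    rwa [zero_smul] at this
  have hpos : ∀ᶠ b in 𝓝 (0 : GluonSpace N), 0 ≤ (G.mcMatrix b).det := by
    have := G.continuous_det_mcMatrix.tendsto 0
    rw [G.det_mcMatrix_zero hκ] at this
    filter_upwards [this.eventually (lt_mem_nhds one_pos)] with b hb using hb.le
  obtain ⟨m, hm⟩ := (hlim.eventually hpos).exists
  have : ∀ (m : ℕ) (b : GluonSpace N), 0 ≤ (G.mcMatrix ((2⁻¹ : ℝ) ^ m • b)).det →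
      0 ≤ (G.mcMatrix b).det := by
    intro m
    induction m with
    | zero => intro b hb; simpa using hb
    | succ m ih =>
      intro b hb
      refine ih b ?_
      have h := hstep _ hb
      rw [smul_smul] at h
      have h2 : (2 : ℝ) * 2⁻¹ ^ (m + 1) = 2⁻¹ ^ m := by rw [pow_succ]; ring
      rwa [h2] at h
  exact this m b hm

theorem exists_isLocalProduct (G : Generators N κ) (hN : 2 ≤ N) (hκ : κ ≠ 0) :
    ∃ c, G.IsLocalProduct c := by
  obtain ⟨V, L, -, hVo, h0, hLV, hO, -, han⟩ := G.exists_chart hN hκ univ_mem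
  have hL0 : L (G.U 0 * G.U 0) = 0 := by
    have := hLV 0 h0
    rwa [U_zero, ← mul_one (1 : specialUnitaryGroup (Fin N) ℂ), ← U_zero G] at this
  refine ⟨fun a b => L (G.U b * G.U a), ?_, ?_⟩
  · simpa only [hL0] using han.continuousAt.tendsto
  · have hc : Tendsto (fun p : GluonSpace N × GluonSpace N => G.U p.2 * G.U p.1) (𝓝 (0, 0))
        (𝓝 1) := by
      have : Continuous (fun p : GluonSpace N × GluonSpace N => G.U p.2 * G.U p.1) :=
        (G.continuous_U.comp continuous_snd).mul (G.continuous_U.comp continuous_fst)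
      simpa [U_zero] using this.tendsto (0, 0)
    filter_upwards [hc.eventually (hO.mem_nhds ⟨0, h0, G.U_zero⟩)] with p hp
    obtain ⟨v, hv, hvp⟩ := hp
    rw [← hvp, hLV v hv]

/-- Since `c` tends to `0`, it stays in the chart, where it must equal the analytic function `L
(U(b) U(a))`. -/
theorem IsLocalProduct.analyticAt {G : Generators N κ} (hN : 2 ≤ N) (hκ : κ ≠ 0)
    {c : GluonSpace N → GluonSpace N → GluonSpace N} (hc : G.IsLocalProduct c) :
    AnalyticAt ℝ (fun p : GluonSpace N × GluonSpace N => c p.1 p.2) (0, 0) := by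
  obtain ⟨V, L, -, hVo, h0, hLV, hO, -, han⟩ := G.exists_chart hN hκ univ_mem
  refine han.congr ?_
  filter_upwards [hc.1.eventually (hVo.mem_nhds h0), hc.2] with p hp h
  rw [h, hLV _ hp]

/-- The map `a ↦ c(a, b)` is left translation by `U(b)`. Invariance of the form at `a = 0`, with
`c(0, b) = b` and `W(0) = 1`, is the claim. -/
theorem IsLocalProduct.eventually_mcMatrix_mul {G : Generators N κ} (hN : 2 ≤ N) (hκ : κ ≠ 0)
    {c : GluonSpace N → GluonSpace N → GluonSpace N} (hc : G.IsLocalProduct c) :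
    ∀ᶠ b in 𝓝 0, G.mcMatrix b * jacobianAtZero c b = 1 := by
  obtain ⟨V, L, -, hVo, h0, hLV, -⟩ := G.exists_chart hN hκ univ_mem
  have hi : Tendsto (fun b : GluonSpace N => ((0 : GluonSpace N), b)) (𝓝 0) (𝓝 (0, 0)) :=
    (Continuous.prodMk_right (0 : GluonSpace N)).tendsto 0
  have h1 := hi.eventually (hc.analyticAt hN hκ).eventually_analyticAt
  have h2 := hi.eventually hc.2.eventually_nhds
  have h3 := hi.eventually (hc.1.eventually (hVo.mem_nhds h0))
  filter_upwards [h1, h2, h3, hVo.mem_nhds h0] with b hb1 hb2 hb3 hb4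
  have hcb : c 0 b = b := by
    have h := hb2.self_of_nhds
    simp only [U_zero, mul_one] at h
    rw [← hLV _ hb3, ← h, hLV b hb4]
  have hj : ContinuousAt (fun a : GluonSpace N => (a, b)) 0 :=
    (Continuous.prodMk_left b).continuousAt
  have hd : HasFDerivAt (fun a => c a b) (fderiv ℝ (fun a => c a b) 0) 0 :=
    (DifferentiableAt.comp (f := fun a : GluonSpace N => (a, b)) (0 : GluonSpace N)
      hb1.differentiableAt (by fun_prop)).hasFDerivAt
  have hev : ∀ᶠ a in 𝓝 (0 : GluonSpace N), G.U (c a b) = G.U b * G.U a :=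
    (hj.eventually hb2).mono fun a ha => ha.symm
  have h := G.mcMatrix_pullback hd hev
  rw [hcb, G.mcMatrix_zero hκ] at h
  have hjac : jacobianAtZero c b = coordMatrix (fderiv ℝ (fun a => c a b) 0) := by
    ext i j
    simp only [jacobianAtZero, coordMatrix, of_apply]
    have hp := ((EuclideanSpace.proj i : GluonSpace N →L[ℝ] ℝ).hasFDerivAt.comp
      (0 : GluonSpace N) hd).fderiv
    exact congrArg (fun D : GluonSpace N →L[ℝ] ℝ => D (EuclideanSpace.single j 1)) hp
  rw [hjac, h]

end Generators

/-! ### Tools for expansions with error `O(t³)`. -/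

theorem Asymptotics.IsBigO.mul_sub_mul {α R : Type*} [NormedRing R] {l : Filter α}
    {f f₀ h h₀ : α → R} {g : α → ℝ} (hf : (fun x => f x - f₀ x) =O[l] g)
    (hh : (fun x => h x - h₀ x) =O[l] g) (hb : f =O[l] (fun _ => (1 : ℝ)))
    (hb₀ : h₀ =O[l] (fun _ => (1 : ℝ))) :
    (fun x => f x * h x - f₀ x * h₀ x) =O[l] g := by
  have h1 : (fun x => f x * (h x - h₀ x)) =O[l] fun x => 1 * g x := hb.mul hh
  have h2 : (fun x => (f x - f₀ x) * h₀ x) =O[l] fun x => g x * 1 := hf.mul hb₀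
  simp only [one_mul, mul_one] at h1 h2
  refine (h1.add h2).congr_left fun x => ?_
  noncomm_ring

theorem ContinuousAt.isBigO_one_nhds {E R : Type*} [TopologicalSpace E] [NormedRing R]
    {f : E → R} {x : E} (h : ContinuousAt f x) : f =O[𝓝 x] (fun _ => (1 : ℝ)) :=
  h.tendsto.isBigO_one ℝ

theorem eq_zero_of_mul_pow_isBigO {a : ℝ} {m : ℕ}
    (h : (fun t : ℝ => a * t ^ m) =O[𝓝 0] fun t : ℝ => t ^ (m + 1)) : a = 0 := by
  by_contra ha
  have h1 : (fun t : ℝ => t ^ m) =O[𝓝 0] fun t : ℝ => t ^ (m + 1) :=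
    (isBigO_const_mul_left_iff ha).1 h
  have h2 : (fun t : ℝ => t ^ m) =o[𝓝 0] fun t : ℝ => t ^ m :=
    h1.trans_isLittleO (isLittleO_pow_pow (Nat.lt_succ_self m))
  refine isLittleO_irrefl ?_ h2
  have h3 : ∃ᶠ t : ℝ in 𝓝[≠] 0, t ^ m ≠ 0 := by
    refine Eventually.frequently ?_
    filter_upwards [self_mem_nhdsWithin] with t ht using pow_ne_zero _ ht
  exact h3.filter_mono nhdsWithin_le_nhds

/-- The determinant is differentiable at `1`, so an entrywise error passes to it with the same
order. -/
theorem Matrix.det_sub_one_isBigO {n : Type*} [Fintype n] [DecidableEq n] {A : ℝ → Matrix n n ℝ}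
    {g : ℝ → ℝ} {l : Filter ℝ}
    (h : ∀ i j, (fun t => A t i j - (1 : Matrix n n ℝ) i j) =O[l] g) (hg : Tendsto g l (𝓝 0)) :
    (fun t => (A t).det - 1) =O[l] g := by
  let F : (n → n → ℝ) → ℝ := fun B => (Matrix.of B).det
  let B₀ : n → n → ℝ := fun i j => (1 : Matrix n n ℝ) i j
  have hF : DifferentiableAt ℝ F B₀ := by
    refine (AnalyticAt.matrix_det fun i j => ?_).differentiableAt
    exact ((ContinuousLinearMap.proj (R := ℝ) (φ := fun _ : n => ℝ) j).comp
      (ContinuousLinearMap.proj (R := ℝ) (φ := fun _ : n => n → ℝ) i)).analyticAt _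
  have hAB : (fun t => (fun i j => A t i j) - B₀) =O[l] g :=
    isBigO_pi.2 fun i => isBigO_pi.2 fun j => h i j
  have hlim : Tendsto (fun t => (fun i j => A t i j : n → n → ℝ)) l (𝓝 B₀) :=
    tendsto_sub_nhds_zero_iff.1 (hAB.trans_tendsto hg)
  have h1 := (hF.hasFDerivAt.isBigO_sub.comp_tendsto hlim).trans hAB
  have h2 : F B₀ = 1 := det_one
  refine h1.congr_left fun t => ?_
  simp only [Function.comp_apply, h2]
  rfl

theorem NormedSpace.exp_smul_isBigO {R : Type*} [NormedRing R] [NormedAlgebra ℝ R]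
    [CompleteSpace R] (X : R) :
    (fun t : ℝ => NormedSpace.exp (t • X) - (1 + t • X + (t ^ 2 / 2) • (X * X)))
      =O[𝓝 0] fun t : ℝ => t ^ 3 := by
  have h := (NormedSpace.exp_hasFPowerSeriesAt_zero (𝕂 := ℝ) (𝔸 := R)).isBigO_sub_partialSum_pow 3
  have hlim : Tendsto (fun t : ℝ => t • X) (𝓝 0) (𝓝 0) := by
    have : Continuous (fun t : ℝ => t • X) := by fun_prop
    simpa using this.tendsto 0
  have h2 : (fun t : ℝ => ‖t • X‖ ^ 3) =O[𝓝 0] fun t : ℝ => t ^ 3 := by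
    refine IsBigO.of_bound (‖X‖ ^ 3) (Eventually.of_forall fun t => ?_)
    rw [norm_smul, mul_pow, norm_mul, norm_pow, norm_pow, norm_pow, norm_norm, norm_norm, mul_comm]
  refine ((h.comp_tendsto hlim).trans h2).congr_left fun t => ?_
  simp only [Function.comp_apply, zero_add, FormalMultilinearSeries.partialSum,
    Finset.sum_range_succ, Finset.sum_range_zero, NormedSpace.expSeries_apply_eq]
  simp [pow_two]
  module

/-- Second-order expansion of the adjoint action of `exp (t X)`. -/
theorem NormedSpace.exp_conj_isBigO {R : Type*} [NormedRing R] [NormedAlgebra ℝ R]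
    [CompleteSpace R] (X Y : R) :
    (fun t : ℝ => NormedSpace.exp (-(t • X)) * Y * NormedSpace.exp (t • X)
        - (Y - t • (X * Y - Y * X)
          + (t ^ 2 / 2) • (X * (X * Y - Y * X) - (X * Y - Y * X) * X)))
      =O[𝓝 0] fun t : ℝ => t ^ 3 := by
  have h1 := NormedSpace.exp_smul_isBigO X
  have h2 := NormedSpace.exp_smul_isBigO (-X)
  simp only [smul_neg] at h2
  have hexp : Continuous (NormedSpace.exp : R → R) := 
    continuous_iff_continuousAt.2 fun x => (NormedSpace.exp_analytic (𝕂 := ℝ) x).continuousAt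
  have hY : (fun _ : ℝ => Y - Y) =O[𝓝 0] fun t : ℝ => t ^ 3 := by
    simpa using isBigO_zero _ _
  have h3 := h2.mul_sub_mul hY (Continuous.continuousAt (by fun_prop)).isBigO_one_nhds
    (Continuous.continuousAt (by fun_prop)).isBigO_one_nhds
  have h4 := h3.mul_sub_mul h1 (Continuous.continuousAt (by fun_prop)).isBigO_one_nhds
    (Continuous.continuousAt (by fun_prop)).isBigO_one_nhds
  -- The terms of order `t³` and `t⁴` in the product of the two quadratic truncations around `Y`.
  have h5 : (fun t : ℝ => t ^ 3 • ((2⁻¹ : ℝ) • (X * X * Y * X - X * Y * X * X)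
      + (t / 4) • (X * X * Y * X * X))) =O[𝓝 0] fun t : ℝ => t ^ 3 * 1 := by
    simp only [← smul_eq_mul (a := _ ^ 3)]
    exact (isBigO_refl _ _).smul (Continuous.continuousAt (by fun_prop)).isBigO_one_nhds
  simp only [mul_one] at h5
  refine (h4.add h5).congr_left fun t => ?_
  simp only [mul_add, add_mul, mul_sub, sub_mul, smul_mul_assoc, mul_smul_comm, neg_mul, mul_neg,
    one_mul, mul_one, ← mul_assoc]
  module

theorem NormedSpace.apply_exp_conj_isBigO {R : Type*} [NormedRing R] [NormedAlgebra ℝ R]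
    [FiniteDimensional ℝ R] (F : R →ₗ[ℝ] ℝ) (X Y : R) :
    (fun t : ℝ => F (NormedSpace.exp (-(t • X)) * Y * NormedSpace.exp (t • X))
        - (F Y - t * F (X * Y - Y * X)
          + t ^ 2 / 2 * F (X * (X * Y - Y * X) - (X * Y - Y * X) * X)))
      =O[𝓝 0] fun t : ℝ => t ^ 3 := by
  have : CompleteSpace R := FiniteDimensional.complete ℝ R
  have h := ((LinearMap.toContinuousLinearMap F).isBigO_comp _ (𝓝 (0 : ℝ))).trans
    (NormedSpace.exp_conj_isBigO X Y)
  refine h.congr_left fun t => ?_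
  simp only [LinearMap.coe_toContinuousLinearMap', map_sub, map_add, map_smul, smul_eq_mul]

/-! ### The adjoint representation and the second-order expansion of `det W`. -/

section Norm

attribute [local instance] Matrix.linftyOpNormedRing Matrix.linftyOpNormedAlgebra

namespace Generators

variable {N : ℕ} {κ : ℝ}

/-- The matrix of `ad (i b · θ)` on the Lie algebra. -/
def adGen (G : Generators N κ) (b : GluonSpace N) :
    Matrix (Fin (N ^ 2 - 1)) (Fin (N ^ 2 - 1)) ℝ :=
  Matrix.of fun j k => G.coord (G.dotI b * G.dotI (EuclideanSpace.single k 1)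
    - G.dotI (EuclideanSpace.single k 1) * G.dotI b) j

theorem dotI_single (G : Generators N κ) (k : Fin (N ^ 2 - 1)) :
    G.dotI (EuclideanSpace.single k 1) = Complex.I • G.θ k := by
  rw [dotI_apply, dot]
  congr 1
  simp

theorem adGen_apply (G : Generators N κ) (hκ : 0 < κ) (b : GluonSpace N)
    (j k : Fin (N ^ 2 - 1)) :
    G.adGen b j k = -√(2 * κ) * ∑ i, b i * G.f i k j := by
  have hs : (√(2 * κ) : ℝ) ≠ 0 := (Real.sqrt_pos.2 (by positivity)).ne'
  have h1 : G.dotI b * G.dotI (EuclideanSpace.single k 1)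
      - G.dotI (EuclideanSpace.single k 1) * G.dotI b
      = -∑ i, (b i : ℂ) • (G.θ i * G.θ k - G.θ k * G.θ i) := by
    rw [dotI_single, dotI_apply, smul_mul_smul_comm, smul_mul_smul_comm, Complex.I_mul_I, dot]
    simp [Finset.sum_mul, Finset.mul_sum, smul_sub, Finset.sum_sub_distrib]
    abel
  have h2 : ∀ i, ((G.θ j * (G.θ i * G.θ k - G.θ k * G.θ i)).trace).im
      = κ * √(2 * κ) * G.f i k j := by
    intro i
    rw [f, trace_mul_comm]
    field_simp
  rw [adGen, of_apply, h1, coord_apply]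
  simp only [mul_neg, trace_neg, Complex.neg_im, Finset.mul_sum, trace_sum, mul_smul_comm,
    trace_smul, Complex.im_sum, smul_eq_mul, Complex.im_ofReal_mul, h2,
    neg_mul, ← Finset.sum_neg_distrib]
  refine Finset.sum_congr rfl fun i _ => ?_
  field_simp

/-- Antisymmetry comes from that of `f` in its last two indices. -/
theorem transpose_adGen (G : Generators N κ) (hκ : 0 < κ) (b : GluonSpace N) :
    (G.adGen b)ᵀ = -G.adGen b := by
  ext j k
  rw [transpose_apply, Matrix.neg_apply, adGen_apply G hκ, adGen_apply G hκ]
  simp only [G.f_swap_right _ j k, mul_neg, Finset.sum_neg_distrib]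

theorem trace_adGen_sq (G : Generators N κ) (hκ : 0 < κ) (b : GluonSpace N) :
    (G.adGen b * G.adGen b).trace = -(2 * κ) * G.casimirForm b := by
  have hs : √(2 * κ) * √(2 * κ) = 2 * κ := Real.mul_self_sqrt (by positivity)
  have h1 : (G.adGen b * G.adGen b).trace
      = ∑ k, ∑ l, -(2 * κ) * ((∑ i, b i * G.f i k l) * ∑ j, b j * G.f j k l) := by
    rw [Matrix.trace]
    refine Finset.sum_congr rfl fun k _ => ?_
    rw [diag_apply, mul_apply]
    refine Finset.sum_congr rfl fun l _ => ?_
    have h2 : G.adGen b k l = -G.adGen b l k := by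
      have := congrFun (congrFun (G.transpose_adGen hκ b) l) k
      simpa using this
    rw [h2, adGen_apply G hκ]
    linear_combination (-(∑ i, b i * G.f i k l) * ∑ j, b j * G.f j k l) * hs
  have h3 : ∀ k l, -(2 * κ) * ((∑ i, b i * G.f i k l) * ∑ j, b j * G.f j k l)
      = ∑ i, ∑ j, -(2 * κ) * (b i * (G.f i k l * G.f j k l) * b j) := by
    intro k l
    rw [Finset.sum_mul_sum]
    simp only [Finset.mul_sum]
    exact Finset.sum_congr rfl fun i _ => Finset.sum_congr rfl fun j _ => by ring
  rw [h1, Finset.sum_congr rfl fun k _ => Finset.sum_congr rfl fun l _ => h3 k l]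
  simp only [casimirForm, casimir, of_apply, Finset.mul_sum, Finset.sum_mul]
  rw [Finset.sum_congr rfl fun k _ => Finset.sum_comm, Finset.sum_comm]
  refine Finset.sum_congr rfl fun i _ => ?_
  rw [Finset.sum_congr rfl fun k _ => Finset.sum_comm, Finset.sum_comm]

theorem coord_commutator (G : Generators N κ) (b x : GluonSpace N) (j : Fin (N ^ 2 - 1)) :
    G.coord (G.dotI b * G.dotI x - G.dotI x * G.dotI b) j = ∑ k, G.adGen b j k * x k := by
  conv_lhs => rw [← sum_smul_single x]
  simp only [map_sum, map_smul, Finset.mul_sum, Finset.sum_mul, mul_smul_comm, smul_mul_assoc,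
    ← Finset.sum_sub_distrib, ← smul_sub, WithLp.ofLp_sum, Finset.sum_apply, PiLp.smul_apply,
    smul_eq_mul]
  exact Finset.sum_congr rfl fun k _ => mul_comm _ _

theorem dotI_coord_commutator (G : Generators N κ) (hN : 2 ≤ N) (hκ : κ ≠ 0)
    (b x : GluonSpace N) :
    G.dotI (G.coord (G.dotI b * G.dotI x - G.dotI x * G.dotI b))
      = G.dotI b * G.dotI x - G.dotI x * G.dotI b := by
  refine G.dotI_coord hN hκ ?_ ?_
  · simp only [conjTranspose_sub, conjTranspose_mul, conjTranspose_dotI]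
    simp
  · rw [trace_sub, trace_mul_comm, sub_self]

theorem adMatrix_isBigO (G : Generators N κ) (hN : 2 ≤ N) (hκ : κ ≠ 0) (b : GluonSpace N)
    (j k : Fin (N ^ 2 - 1)) :
    (fun t : ℝ => G.adMatrix (G.U (t • b)) j k - (1 - t • G.adGen b
      + (t ^ 2 / 2) • (G.adGen b * G.adGen b) : Matrix (Fin (N ^ 2 - 1)) (Fin (N ^ 2 - 1)) ℝ) j k) =O[𝓝 0] fun t : ℝ => t ^ 3 := by
  set Y := G.dotI (EuclideanSpace.single k 1) with hY
  let F : Matrix (Fin N) (Fin N) ℂ →ₗ[ℝ] ℝ :=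
    (EuclideanSpace.proj j : GluonSpace N →L[ℝ] ℝ).toLinearMap ∘ₗ G.coord
  have hF : ∀ A, F A = G.coord A j := fun _ => rfl
  have hM : F (G.dotI b * (G.dotI b * Y - Y * G.dotI b)
      - (G.dotI b * Y - Y * G.dotI b) * G.dotI b) = (G.adGen b * G.adGen b) j k := by
    rw [hF, hY, ← G.dotI_coord_commutator hN hκ, coord_commutator, mul_apply]
    rfl
  have hM1 : F (G.dotI b * Y - Y * G.dotI b) = G.adGen b j k := rfl
  have hM0 : F Y = (1 : Matrix (Fin (N ^ 2 - 1)) (Fin (N ^ 2 - 1)) ℝ) j k := by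
    rw [hF, hY, G.coord_dotI hκ]
    simp [one_apply]
  have h1 := NormedSpace.apply_exp_conj_isBigO F (G.dotI b) Y
  rw [hM, hM1, hM0] at h1
  have hA : ∀ t : ℝ, F (NormedSpace.exp (-(t • G.dotI b)) * Y * NormedSpace.exp (t • G.dotI b))
      = G.adMatrix (G.U (t • b)) j k := by
    intro t
    rw [hF, adMatrix, of_apply, ← U_neg, coe_U, coe_U, map_neg, map_smul]
  refine h1.congr_left fun t => ?_
  refine congrArg₂ (fun x y : ℝ => x - y) (hA t) ?_
  rw [Matrix.add_apply, Matrix.sub_apply, Matrix.smul_apply, Matrix.smul_apply, smul_eq_mul,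
    smul_eq_mul]

end Generators

end Norm

namespace Generators

variable {N : ℕ} {κ : ℝ}

/-- By antisymmetry `1 + tM/2` and its transpose `1 - tM/2` have the same determinant, so the square
is `det (1 - t²M²/4)`. Its linear term in `t²` is `-tr (M²)/4`, the Casimir form up to a factor. -/
theorem det_one_add_half_adGen_sq (G : Generators N κ) (hκ : 0 < κ) (b : GluonSpace N) :
    (fun t : ℝ => (1 + (t / 2) • G.adGen b).det ^ 2
        - (1 + κ / 2 * G.casimirForm b * t ^ 2)) =O[𝓝 0] fun t : ℝ => t ^ 3 := by
  set M := G.adGen b with hM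
  have h1 : ∀ t : ℝ, (1 + (t / 2) • M).det ^ 2 = (1 + (-(t ^ 2 / 4)) • (M * M)).det := by
    intro t
    have h2 : (1 + (t / 2) • M).det = (1 - (t / 2) • M).det := by
      rw [← det_transpose, transpose_add, transpose_smul, G.transpose_adGen hκ, transpose_one,
        smul_neg, sub_eq_add_neg]
    rw [sq]
    nth_rewrite 2 [h2]
    rw [← det_mul, add_mul, one_mul, mul_sub, mul_one, smul_mul_smul_comm]
    congr 1
    module
  -- `det (1 + x M²) = 1 + x tr (M²) + x² p(x)`; with `x = -t²/4` the remainder is of order `t⁴`.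
  set p := (det (1 + (Polynomial.X : Polynomial ℝ) • (M * M).map Polynomial.C)).divX.divX with hp
  have h3 : ∀ t : ℝ, (1 + (t / 2) • M).det ^ 2 - (1 + κ / 2 * G.casimirForm b * t ^ 2)
      = t ^ 3 * (t / 16 * p.eval (-(t ^ 2 / 4))) := by
    intro t
    rw [h1, det_one_add_smul, ← hp, G.trace_adGen_sq hκ]
    ring
  simp only [h3]
  have h4 : (fun t : ℝ => t / 16 * p.eval (-(t ^ 2 / 4))) =O[𝓝 0] fun _ => (1 : ℝ) :=
    (Continuous.continuousAt (by
      have := p.continuous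
      fun_prop)).isBigO_one_nhds
  simpa using (isBigO_refl (fun t : ℝ => t ^ 3) (𝓝 0)).mul h4

/-- With `Ad = 1 - tM + t²M²/2 + O(t³)`, the product `(1 + Ad)/2 · (1 + tM/2)` has no terms of order
`t` or `t²`: they cancel, leaving `t³M³/8` and the error. -/
theorem det_half_one_add_adMatrix (G : Generators N κ) (hN : 2 ≤ N) (hκ : κ ≠ 0)
    (b : GluonSpace N) :
    (fun t : ℝ => ((2⁻¹ : ℝ) • (1 + G.adMatrix (G.U (t • b)))).det
      * (1 + (t / 2) • G.adGen b).det - 1) =O[𝓝 0] fun t : ℝ => t ^ 3 := by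
  set M := G.adGen b with hM
  have hlim : Tendsto (fun t : ℝ => t ^ 3) (𝓝 0) (𝓝 0) := by
    have : Continuous fun t : ℝ => t ^ 3 := by fun_prop
    simpa using this.tendsto 0
  have key : ∀ i j, (fun t : ℝ => (((2⁻¹ : ℝ) • (1 + G.adMatrix (G.U (t • b))))
      * (1 + (t / 2) • M)) i j - (1 : Matrix (Fin (N ^ 2 - 1)) (Fin (N ^ 2 - 1)) ℝ) i j)
      =O[𝓝 0] fun t : ℝ => t ^ 3 := by
    intro i j
    set E : ℝ → Matrix (Fin (N ^ 2 - 1)) (Fin (N ^ 2 - 1)) ℝ := fun t =>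
      G.adMatrix (G.U (t • b)) - (1 - t • M + (t ^ 2 / 2) • (M * M)) with hE
    have hEO : ∀ i j, (fun t => E t i j) =O[𝓝 0] fun t : ℝ => t ^ 3 :=
      G.adMatrix_isBigO hN hκ b
    have h1 : ∀ t : ℝ, ((2⁻¹ : ℝ) • (1 + G.adMatrix (G.U (t • b)))) * (1 + (t / 2) • M) - 1
        = (2⁻¹ : ℝ) • (E t * (1 + (t / 2) • M)) + (t ^ 3 / 8) • (M * M * M) := by
      intro t
      have h2 : G.adMatrix (G.U (t • b)) = E t + (1 - t • M + (t ^ 2 / 2) • (M * M)) := by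
        exact (sub_add_cancel _ _).symm
      rw [h2]
      simp only [mul_add, add_mul, sub_mul, smul_mul_assoc, mul_smul_comm, one_mul, mul_one]
      module
    have h3 : (fun t : ℝ => 2⁻¹ * (∑ k, E t i k * (1 + (t / 2) • M) k j)
        + t ^ 3 / 8 * (M * M * M) i j) =O[𝓝 0] fun t : ℝ => t ^ 3 := by
      refine IsBigO.add (IsBigO.const_mul_left (IsBigO.fun_sum fun k _ => ?_) _) ?_
      · have hc : (fun t : ℝ => (1 + (t / 2) • M) k j) =O[𝓝 0] fun _ => (1 : ℝ) := by
          refine (Continuous.continuousAt ?_).isBigO_one_nhds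
          simp only [Matrix.add_apply, Matrix.smul_apply, smul_eq_mul]
          fun_prop
        simpa using (hEO i k).mul hc
      · refine ((isBigO_refl (fun t : ℝ => t ^ 3) (𝓝 0)).const_mul_left
          ((M * M * M) i j / 8)).congr_left fun t => by ring
    refine h3.congr_left fun t => ?_
    rw [← Matrix.sub_apply, h1, Matrix.add_apply, Matrix.smul_apply, Matrix.smul_apply,
      mul_apply (M := E t), smul_eq_mul, smul_eq_mul]
  simpa only [det_mul] using det_sub_one_isBigO key hlim

/-- The determinant of the Maurer-Cartan matrix to second order. -/
theorem det_mcMatrix_isBigO (G : Generators N κ) (hN : 2 ≤ N) (hκ : 0 < κ) :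
    (fun b => (G.mcMatrix b).det - (1 - κ / 2 * (1 / 6 * G.casimirForm b)))
      =O[𝓝 0] fun b : GluonSpace N => ‖b‖ ^ 3 := by
  obtain ⟨p, hp⟩ := G.analyticAt_det_mcMatrix 0
  have hO := hp.isBigO_sub_partialSum_pow 3
  simp only [zero_add, FormalMultilinearSeries.partialSum, Finset.sum_range_succ,
    Finset.sum_range_zero] at hO
  have hp0 : ∀ y : GluonSpace N, p 0 (fun _ => y) = 1 := by
    intro y
    rw [hp.coeff_zero, G.det_mcMatrix_zero hκ.ne']
  simp only [hp0] at hO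
  -- The coefficients of degree one and two are found on each line `t ↦ tb` from the doubling
  -- relation.
  have hcoeff : ∀ b : GluonSpace N, p 1 (fun _ => b) = 0 ∧
      p 2 (fun _ => b) = -(κ / 2 * (1 / 6 * G.casimirForm b)) := by
    intro b
    set α := p 1 (fun _ => b) with hα
    set β := p 2 (fun _ => b) with hβ
    set τ := κ / 2 * G.casimirForm b with hτ
    set D : ℝ → ℝ := fun t => (G.mcMatrix (t • b)).det with hD
    set q : ℝ → ℝ := fun t => 1 + t * α + t ^ 2 * β with hq
    have hDc : Continuous D := G.continuous_det_mcMatrix.comp (by fun_prop)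
    have hDq : (fun t => D t - q t) =O[𝓝 0] fun t : ℝ => t ^ 3 := by
      have hlim : Tendsto (fun t : ℝ => t • b) (𝓝 0) (𝓝 0) := by
        have : Continuous (fun t : ℝ => t • b) := by fun_prop
        simpa using this.tendsto 0
      have h2 : (fun t : ℝ => ‖t • b‖ ^ 3) =O[𝓝 0] fun t : ℝ => t ^ 3 := by
        refine IsBigO.of_bound (‖b‖ ^ 3) (Eventually.of_forall fun t => ?_)
        rw [norm_smul, mul_pow, norm_mul, norm_pow, norm_pow, norm_pow, norm_norm, norm_norm,
          mul_comm]
      refine ((hO.comp_tendsto hlim).trans h2).congr_left fun t => ?_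
      have e1 : p 1 (fun _ => t • b) = t * α := by
        rw [(p 1).map_smul_univ (fun _ => t) (fun _ => b)]; simp [hα]
      have e2 : p 2 (fun _ => t • b) = t ^ 2 * β := by
        rw [(p 2).map_smul_univ (fun _ => t) (fun _ => b)]; simp [hβ]
      simp only [Function.comp_apply, e1, e2, hD, hq]
    have hD2q : (fun t => D (2 * t) - q (2 * t)) =O[𝓝 0] fun t : ℝ => t ^ 3 := by
      have hlim : Tendsto (fun t : ℝ => 2 * t) (𝓝 0) (𝓝 0) := by
        have : Continuous (fun t : ℝ => 2 * t) := by fun_prop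
        simpa using this.tendsto 0
      refine (hDq.comp_tendsto hlim).trans ?_
      exact ((isBigO_refl (fun t : ℝ => t ^ 3) (𝓝 0)).const_mul_left 8).congr_left fun t => by
        simp only [Function.comp_apply]; ring
    set P : ℝ → ℝ := fun t => (1 + (t / 2) • G.adGen b).det with hP
    set z : ℝ → ℝ := fun t => ((2⁻¹ : ℝ) • (1 + G.adMatrix (G.U (t • b)))).det * P t with hz
    have hz1 : (fun t => z t - 1) =O[𝓝 0] fun t : ℝ => t ^ 3 :=
      G.det_half_one_add_adMatrix hN hκ.ne' b
    have hP2 : (fun t => P t ^ 2 - (1 + τ * t ^ 2)) =O[𝓝 0] fun t : ℝ => t ^ 3 :=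
      G.det_one_add_half_adGen_sq hκ b
    have hrel : ∀ t, D (2 * t) * P t = D t * z t := by
      intro t
      simp only [hD, hz, mul_smul]
      rw [G.det_mcMatrix_two_smul hN hκ.ne']
      ring
    have hqc : Continuous q := by fun_prop
    have hzb : z =O[𝓝 0] fun _ => (1 : ℝ) := by
      have h1 : (fun t : ℝ => t ^ 3) =O[𝓝 0] fun _ => (1 : ℝ) :=
        (Continuous.continuousAt (by fun_prop)).isBigO_one_nhds
      have := (hz1.trans h1).add (isBigO_refl (fun _ : ℝ => (1 : ℝ)) (𝓝 0))
      simpa using this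
    have hone : (fun _ : ℝ => (1 : ℝ)) =O[𝓝 0] fun _ : ℝ => (1 : ℝ) := isBigO_refl _ _
    have hL1 := hD2q.mul_sub_mul hD2q (hDc.comp (continuous_const_mul 2)).continuousAt.isBigO_one_nhds
      (hqc.comp (continuous_const_mul 2)).continuousAt.isBigO_one_nhds
    have hL2 := hL1.mul_sub_mul hP2 (Continuous.continuousAt (by fun_prop)).isBigO_one_nhds
      (Continuous.continuousAt (by fun_prop)).isBigO_one_nhds
    have hR1 := hDq.mul_sub_mul hDq hDc.continuousAt.isBigO_one_nhds
      hqc.continuousAt.isBigO_one_nhds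
    have hR2 := hz1.mul_sub_mul hz1 hzb hone
    have hR3 := hR1.mul_sub_mul hR2 (hDc.mul hDc).continuousAt.isBigO_one_nhds (by simpa using hone)
    -- The relation `D(2t) P(t) = D(t) z(t)` is squared because only `P²` has a known expansion;
    -- then `D`, `P²` and `z` are replaced by their truncations.
    have hpoly : (fun t : ℝ => q (2 * t) * q (2 * t) * (1 + τ * t ^ 2) - q t * q t)
        =O[𝓝 0] fun t : ℝ => t ^ 3 := by
      refine (hR3.sub hL2).congr_left fun t => ?_
      have := hrel t
      linear_combination (-(D (2 * t) * P t) - D t * z t) * this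
    have hcub : (fun t : ℝ => 2 * α * t + (6 * β + 3 * α ^ 2 + τ) * t ^ 2)
        =O[𝓝 0] fun t : ℝ => t ^ 3 := by
      -- All terms of degree at least three in the polynomial of `hpoly`.
      have h1 : (fun t : ℝ => t ^ 3 * (14 * α * β + 4 * α * τ
          + t * (15 * β ^ 2 + 8 * β * τ + 4 * α ^ 2 * τ)
          + t ^ 2 * (16 * α * β * τ) + t ^ 3 * (16 * β ^ 2 * τ))) =O[𝓝 0] fun t : ℝ => t ^ 3 * 1 :=
        (isBigO_refl _ _).mul (Continuous.continuousAt (by fun_prop)).isBigO_one_nhds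
      simp only [mul_one] at h1
      refine (hpoly.sub h1).congr_left fun t => ?_
      simp only [hq]
      ring
    have hα0 : α = 0 := by
      have h23 : (fun t : ℝ => t ^ 3) =O[𝓝 0] fun t : ℝ => t ^ 2 :=
        (isLittleO_pow_pow (by norm_num)).isBigO
      have h1 : (fun t : ℝ => 2 * α * t ^ 1) =O[𝓝 0] fun t : ℝ => t ^ (1 + 1) := by
        refine ((hcub.trans h23).sub ((isBigO_refl (fun t : ℝ => t ^ 2) (𝓝 0)).const_mul_left
          (6 * β + 3 * α ^ 2 + τ))).congr_left fun t => by ring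
      have := eq_zero_of_mul_pow_isBigO h1
      linarith
    refine ⟨hα0, ?_⟩
    have h2 : (fun t : ℝ => (6 * β + τ) * t ^ 2) =O[𝓝 0] fun t : ℝ => t ^ (2 + 1) :=
      hcub.congr_left fun t => by rw [hα0]; ring
    have := eq_zero_of_mul_pow_isBigO h2
    rw [hτ] at this
    linarith
  refine hO.congr_left fun y => ?_
  rw [(hcoeff y).1, (hcoeff y).2]
  ring

theorem casimirForm_eq (G : Generators N κ) (hN : 2 ≤ N) (hκ : 0 < κ) (b : GluonSpace N) :
    G.casimirForm b = N * ‖b‖ ^ 2 := by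
  rw [casimirForm, G.casimir_eq hN hκ, EuclideanSpace.norm_sq_eq]
  simp only [Matrix.smul_apply, one_apply, smul_eq_mul, Finset.mul_sum]
  refine Finset.sum_congr rfl fun i _ => ?_
  simp [sq]
  ring

theorem det_mcMatrix_isBigO_norm (G : Generators N κ) (hN : 2 ≤ N) (hκ : 0 < κ) :
    (fun b => (G.mcMatrix b).det - (1 - κ / 2 * (1 / 6 * N) * ‖b‖ ^ 2))
      =O[𝓝 0] fun b : GluonSpace N => ‖b‖ ^ 3 :=
  (G.det_mcMatrix_isBigO hN hκ).congr_left fun b => by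
    rw [G.casimirForm_eq hN hκ]; ring

end Generators

/-! ### Haar measure in gluon coordinates. -/

section Topology

variable {N : ℕ}

instance : IsTopologicalGroup (specialUnitaryGroup (Fin N) ℂ) where
  continuous_inv := by
    refine continuous_induced_rng.2 ?_
    have : Continuous fun u : specialUnitaryGroup (Fin N) ℂ =>
        star (u : Matrix (Fin N) (Fin N) ℂ) := continuous_subtype_val.star
    exact this

instance : SecondCountableTopology (specialUnitaryGroup (Fin N) ℂ) :=
  have : SecondCountableTopology (Matrix (Fin N) (Fin N) ℂ) :=
    inferInstanceAs (SecondCountableTopology (Fin N → Fin N → ℂ))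
  Topology.IsInducing.subtypeVal.secondCountableTopology

instance : LocallyCompactSpace (specialUnitaryGroup (Fin N) ℂ) := by
  have : LocallyCompactSpace (Matrix (Fin N) (Fin N) ℂ) :=
    inferInstanceAs (LocallyCompactSpace (Fin N → Fin N → ℂ))
  have hclosed : IsClosed ((specialUnitaryGroup (Fin N) ℂ : Submonoid _) :
      Set (Matrix (Fin N) (Fin N) ℂ)) := by
    have : ((specialUnitaryGroup (Fin N) ℂ : Submonoid _) : Set (Matrix (Fin N) (Fin N) ℂ))
        = {A | A * star A = 1} ∩ {A | A.det = 1} := by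
      ext A
      simp [mem_specialUnitaryGroup_iff, mem_unitaryGroup_iff]
    rw [this]
    exact (isClosed_eq (by fun_prop) continuous_const).inter
      (isClosed_eq (continuous_id.matrix_det) continuous_const)
  exact hclosed.isClosedEmbedding_subtypeVal.locallyCompactSpace

end Topology

/-- A probability Haar measure on a locally compact group is right invariant. -/
theorem isMulRightInvariant_of_isProbabilityMeasure {H : Type*} [Group H] [TopologicalSpace H]
    [IsTopologicalGroup H] [LocallyCompactSpace H] [MeasurableSpace H] [BorelSpace H]
    (μ : Measure H) [μ.IsHaarMeasure] [IsProbabilityMeasure μ] : μ.IsMulRightInvariant where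
  map_mul_right_eq_self g := by
    have : IsProbabilityMeasure (μ.map (· * g)) :=
      Measure.isProbabilityMeasure_map (measurable_mul_const g).aemeasurable
    exact Measure.isHaarMeasure_eq_of_isProbabilityMeasure _ _

/-- A finite measure which is invariant under those left translations that do not leave a given set
is proportional there to any finite bi-invariant measure. -/
theorem MeasureTheory.Measure.mul_eq_mul_of_locally_invariant {H : Type*} [Group H]
    [MeasurableSpace H] [MeasurableMul₂ H] [MeasurableInv H] (μ ν : Measure H) [IsFiniteMeasure μ]
    [IsFiniteMeasure ν] [μ.IsMulLeftInvariant] [μ.IsMulRightInvariant] {O E : Set H}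
    (hO : MeasurableSet O) (hE : MeasurableSet E) (hEO : E ⊆ O)
    (hν : ∀ (g : H) (S : Set H), MeasurableSet S → S ⊆ O → (fun y => g⁻¹ * y) ⁻¹' S ⊆ O →
      ν ((fun y => g⁻¹ * y) ⁻¹' S) = ν S) :
    ν O * μ E = ν E * μ O⁻¹ := by
  have hm₁ : MeasurableSet {p : H × H | p.2 ∈ O ∧ p.1 * p.2 ∈ E} :=
    (measurable_snd hO).inter (measurable_mul hE)
  have hm₂ : MeasurableSet {p : H × H | p.2 ∈ E ∧ p.1⁻¹ * p.2 ∈ O} :=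
    (measurable_snd hE).inter ((measurable_fst.inv.mul measurable_snd) hO)
  have h1 : (μ.prod ν) {p : H × H | p.2 ∈ O ∧ p.1 * p.2 ∈ E} = ν O * μ E := by
    rw [Measure.prod_apply_symm hm₁]
    -- For fixed `y ∈ O` the slice is `E y⁻¹`, of measure `μ E` by right invariance. In the second
    -- set the slice over `y ∈ E` is `y O⁻¹`, and left invariance applies.
    have : ∀ y : H, μ ((fun x => (x, y)) ⁻¹' {p : H × H | p.2 ∈ O ∧ p.1 * p.2 ∈ E})
        = O.indicator (fun _ => μ E) y := by
      intro y
      by_cases hy : y ∈ O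
      · rw [Set.indicator_of_mem hy, ← measure_preimage_mul_right μ y E]
        congr 1
        ext x
        simp [hy]
      · simp [hy]
    simp only [this]
    rw [lintegral_indicator hO, setLIntegral_const, mul_comm]
  have h2 : (μ.prod ν) {p : H × H | p.2 ∈ E ∧ p.1⁻¹ * p.2 ∈ O} = ν E * μ O⁻¹ := by
    rw [Measure.prod_apply_symm hm₂]
    have : ∀ y : H, μ ((fun x => (x, y)) ⁻¹' {p : H × H | p.2 ∈ E ∧ p.1⁻¹ * p.2 ∈ O})
        = E.indicator (fun _ => μ O⁻¹) y := by
      intro y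
      by_cases hy : y ∈ E
      · rw [Set.indicator_of_mem hy, ← measure_preimage_mul μ y⁻¹ O⁻¹]
        congr 1
        ext x
        simp [hy]
      · simp [hy]
    simp only [this]
    rw [lintegral_indicator hE, setLIntegral_const, mul_comm]
  have h3 : (μ.prod ν) {p : H × H | p.2 ∈ O ∧ p.1 * p.2 ∈ E}
      = (μ.prod ν) {p : H × H | p.2 ∈ E ∧ p.1⁻¹ * p.2 ∈ O} := by
    rw [Measure.prod_apply hm₁, Measure.prod_apply hm₂]
    refine lintegral_congr fun g => ?_
    -- For fixed `g` the slices are `O ∩ g⁻¹E` and its translate `gO ∩ E`; both lie in `O`, so local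
    -- invariance of `ν` identifies their measures.
    have h4 := hν g (O ∩ (fun x => g * x) ⁻¹' E) (hO.inter (measurable_const_mul g hE))
      Set.inter_subset_left (fun y hy => hEO (by simpa using hy.2))
    refine Eq.trans ?_ (h4.symm.trans ?_)
    · rfl
    · congr 1
      ext y
      simp [and_comm]
  rw [← h1, ← h2, h3]

namespace Generators

variable {N : ℕ} {κ : ℝ}

/-- The integral of `det W` is invariant under maps which are left translations in gluon
coordinates. -/
theorem setLIntegral_det_mcMatrix_image (G : Generators N κ) (hN : 2 ≤ N) (hκ : κ ≠ 0)
    {ψ : GluonSpace N → GluonSpace N} {A : Set (GluonSpace N)} (hA : MeasurableSet A)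
    (hinj : Set.InjOn G.U A) {g : specialUnitaryGroup (Fin N) ℂ}
    (hψ : ∀ b ∈ A, DifferentiableAt ℝ ψ b)
    (hU : ∀ b ∈ A, ∀ᶠ b' in 𝓝 b, G.U (ψ b') = g * G.U b') :
    ∫⁻ b in ψ '' A, ENNReal.ofReal (G.mcMatrix b).det
      = ∫⁻ b in A, ENNReal.ofReal (G.mcMatrix b).det := by
  have hψinj : Set.InjOn ψ A := by
    intro b hb b' hb' h
    refine hinj hb hb' (mul_left_cancel (a := g) ?_)
    rw [← (hU b hb).self_of_nhds, ← (hU b' hb').self_of_nhds, h]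
  rw [lintegral_image_eq_lintegral_abs_det_fderiv_mul volume hA
    (fun b hb => (hψ b hb).hasFDerivAt.hasFDerivWithinAt) hψinj]
  refine setLIntegral_congr_fun hA fun b hb => ?_
  have h := congrArg Matrix.det (G.mcMatrix_pullback (hψ b hb).hasFDerivAt (hU b hb))
  rw [det_mul, det_coordMatrix] at h
  -- Nonnegativity of `det W` at both points is what allows the absolute value of the Jacobian here.
  have hdet : |(fderiv ℝ ψ b).det| * (G.mcMatrix (ψ b)).det = (G.mcMatrix b).det := by
    rw [← abs_of_nonneg (G.det_mcMatrix_nonneg hN hκ b), ← h, abs_mul,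
      abs_of_nonneg (G.det_mcMatrix_nonneg hN hκ (ψ b)), mul_comm]
  rw [← hdet, ENNReal.ofReal_mul (abs_nonneg _)]

/-- In gluon coordinates the Haar measure of `SU(N)` has a constant multiple of `det W` as its
density. -/
theorem exists_haar_eq_setLIntegral (G : Generators N κ) (hN : 2 ≤ N) (hκ : κ ≠ 0)
    [MeasurableSpace (specialUnitaryGroup (Fin N) ℂ)] [BorelSpace (specialUnitaryGroup (Fin N) ℂ)]
    (μ : Measure (specialUnitaryGroup (Fin N) ℂ)) [μ.IsHaarMeasure] [IsProbabilityMeasure μ] :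
    ∃ K : ℝ, 0 < K ∧ ∀ A : Set (GluonSpace N), MeasurableSet A → Set.InjOn G.U A →
      μ (G.U '' A) = ∫⁻ b in A, ENNReal.ofReal (K * (G.mcMatrix b).det) := by
  have := isMulRightInvariant_of_isProbabilityMeasure μ
  set d : GluonSpace N → ENNReal := fun b => ENNReal.ofReal (G.mcMatrix b).det with hd
  have hdm : Measurable d :=
    ENNReal.measurable_ofReal.comp G.continuous_det_mcMatrix.measurable
  have hUm : Measurable G.U := G.continuous_U.measurable
  -- In a chart inside this set `det W` is bounded above and below and the volume is finite, so `ν`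
  -- below is finite and nonzero.
  have hS : {b : GluonSpace N | 1 / 2 < (G.mcMatrix b).det ∧ (G.mcMatrix b).det < 2}
      ∩ Metric.ball 0 1 ∈ 𝓝 0 := by
    have h := G.continuous_det_mcMatrix.tendsto 0
    rw [G.det_mcMatrix_zero hκ] at h
    exact inter_mem (h.eventually (Ioo_mem_nhds (by norm_num) (by norm_num)))
      (Metric.ball_mem_nhds _ one_pos)
  obtain ⟨V, L, hVS, hVo, h0, hLV, hOo, hdiff, -⟩ := G.exists_chart hN hκ hS
  set O := G.U '' V with hO
  have hOm : MeasurableSet O := hOo.measurableSet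
  have hUL : ∀ g b, g * G.U b ∈ O → L (g * G.U b) ∈ V ∧ G.U (L (g * G.U b)) = g * G.U b := by
    rintro g b ⟨v, hv, hvb⟩
    rw [← hvb, hLV v hv]
    exact ⟨hv, rfl⟩
  have hPo : ∀ g : specialUnitaryGroup (Fin N) ℂ, IsOpen {b | g * G.U b ∈ O} := fun g =>
    hOo.preimage (G.continuous_U.const_mul g)
  set ν : Measure (specialUnitaryGroup (Fin N) ℂ) :=
    ((volume.restrict V).withDensity d).map G.U with hν
  have hν_apply : ∀ E, MeasurableSet E → ν E = ∫⁻ b in V ∩ G.U ⁻¹' E, d b := by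
    intro E hE
    rw [hν, Measure.map_apply hUm hE, withDensity_apply _ (hUm hE),
      Measure.restrict_restrict (hUm hE), Set.inter_comm]
  have hνO : ν O = ∫⁻ b in V, d b := by
    rw [hν_apply O hOm, Set.inter_eq_left.2 (Set.subset_preimage_image _ _)]
  have hνfin : ∫⁻ b in V, d b < ⊤ := by
    calc ∫⁻ b in V, d b ≤ ∫⁻ _ in V, ENNReal.ofReal 2 :=
          setLIntegral_mono' hVo.measurableSet fun b hb =>
            ENNReal.ofReal_le_ofReal (hVS hb).1.2.le
      _ = ENNReal.ofReal 2 * volume V := setLIntegral_const _ _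
      _ < ⊤ := ENNReal.mul_lt_top ENNReal.ofReal_lt_top
          ((measure_mono fun b hb => (hVS hb).2).trans_lt measure_ball_lt_top)
  have hνpos : ∫⁻ b in V, d b ≠ 0 := by
    have h1 : ENNReal.ofReal (1 / 2) * volume V ≤ ∫⁻ b in V, d b := by
      rw [← setLIntegral_const]
      exact setLIntegral_mono' hVo.measurableSet fun b hb =>
        ENNReal.ofReal_le_ofReal (hVS hb).1.1.le
    have h2 : ENNReal.ofReal (1 / 2) * volume V ≠ 0 :=
      mul_ne_zero (by simp) (hVo.measure_pos _ ⟨0, h0⟩).ne'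
    intro h
    exact h2 (le_antisymm (h ▸ h1) bot_le)
  have : IsFiniteMeasure ν := ⟨by
    rw [hν_apply _ MeasurableSet.univ, Set.preimage_univ, Set.inter_univ]
    exact hνfin⟩
  -- `A` need not lie in the chart. If `g` moves `U(A)` into `O`, then `b ↦ L (g U(b))` carries `A`
  -- into `V` and preserves the integral of `det W`.
  have htranslate : ∀ (g : specialUnitaryGroup (Fin N) ℂ) (A : Set (GluonSpace N)),
      MeasurableSet A → Set.InjOn G.U A → (∀ b ∈ A, g * G.U b ∈ O) →
      ν ((fun y => g⁻¹ * y) ⁻¹' (G.U '' A)) = ∫⁻ b in A, d b := by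
    intro g A hA hinj hgA
    have hUA : MeasurableSet (G.U '' A) :=
      hA.image_of_continuousOn_injOn G.continuous_U.continuousOn hinj
    rw [hν_apply _ (measurable_const_mul g⁻¹ hUA)]
    have himage : V ∩ G.U ⁻¹' ((fun y => g⁻¹ * y) ⁻¹' (G.U '' A))
        = (fun b => L (g * G.U b)) '' A := by
      ext b
      constructor
      · rintro ⟨hb, a, ha, hab⟩
        refine ⟨a, ha, ?_⟩
        have : g * G.U a = G.U b := by rw [hab]; simp
        simp only [this, hLV b hb]
      · rintro ⟨a, ha, rfl⟩
        obtain ⟨h1, h2⟩ := hUL g a (hgA a ha)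
        refine ⟨h1, a, ha, ?_⟩
        simp only [h2]
        simp
    rw [himage]
    refine G.setLIntegral_det_mcMatrix_image hN hκ hA hinj (g := g)
      (fun b hb => hdiff g b (hgA b hb)) fun b hb => ?_
    filter_upwards [(hPo g).mem_nhds (hgA b hb)] with b' hb' using (hUL g b' hb').2
  have hinv : ∀ (g : specialUnitaryGroup (Fin N) ℂ) (S : Set (specialUnitaryGroup (Fin N) ℂ)),
      MeasurableSet S → S ⊆ O → (fun y => g⁻¹ * y) ⁻¹' S ⊆ O →
      ν ((fun y => g⁻¹ * y) ⁻¹' S) = ν S := by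
    intro g S hSm hSO hgS
    have hA : MeasurableSet (V ∩ G.U ⁻¹' S) := hVo.measurableSet.inter (hUm hSm)
    have hUA : G.U '' (V ∩ G.U ⁻¹' S) = S := by
      rw [Set.image_inter_preimage]
      exact Set.inter_eq_right.2 hSO
    have hinj : Set.InjOn G.U (V ∩ G.U ⁻¹' S) := fun b hb b' hb' h => by
      rw [← hLV b hb.1, ← hLV b' hb'.1, h]
    have h := htranslate g _ hA hinj fun b hb => hgS (by simpa using hb.2)
    rw [hUA] at h
    rw [h, hν_apply S hSm]
  have hunique : ∀ E, MeasurableSet E → E ⊆ O → ν O * μ E = ν E * μ O⁻¹ := fun E hE hEO =>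
    Measure.mul_eq_mul_of_locally_invariant μ ν hOm hE hEO hinv
  have hO1 : (1 : specialUnitaryGroup (Fin N) ℂ) ∈ O := ⟨0, h0, G.U_zero⟩
  have hOinv : μ O⁻¹ ≠ 0 := (hOo.inv.measure_pos μ ⟨1, by simpa using hO1⟩).ne'
  -- The constant comes from `hunique`; it does not depend on the translation used in `hlocal`.
  set k : ENNReal := μ O⁻¹ / ν O with hk
  have hνO0 : ν O ≠ 0 := hνO ▸ hνpos
  have hk0 : k ≠ 0 := ENNReal.div_ne_zero.2 ⟨hOinv, measure_ne_top _ _⟩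
  have hkt : k ≠ ⊤ := ENNReal.div_ne_top (measure_ne_top _ _) hνO0
  have hlocal : ∀ (g : specialUnitaryGroup (Fin N) ℂ) (A : Set (GluonSpace N)),
      MeasurableSet A → Set.InjOn G.U A → (∀ b ∈ A, g * G.U b ∈ O) →
      μ (G.U '' A) = k * ∫⁻ b in A, d b := by
    intro g A hA hinj hgA
    have hUA : MeasurableSet (G.U '' A) :=
      hA.image_of_continuousOn_injOn G.continuous_U.continuousOn hinj
    have hsub : (fun y => g⁻¹ * y) ⁻¹' (G.U '' A) ⊆ O := by
      rintro y ⟨a, ha, hay⟩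
      have : y = g * G.U a := by rw [hay]; simp
      exact this ▸ hgA a ha
    rw [← htranslate g A hA hinj hgA, ← measure_preimage_mul μ g⁻¹ (G.U '' A), hk,
      ENNReal.div_eq_inv_mul, mul_assoc, mul_comm (μ O⁻¹),
      ← hunique _ (measurable_const_mul g⁻¹ hUA) hsub, ← mul_assoc,
      ENNReal.inv_mul_cancel hνO0 (measure_ne_top _ _), one_mul]
  refine ⟨k.toReal, ENNReal.toReal_pos hk0 hkt, fun A hA hinj => ?_⟩
  have hK : ∀ b, ENNReal.ofReal (k.toReal * (G.mcMatrix b).det) = k * d b := fun b => by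
    rw [ENNReal.ofReal_mul ENNReal.toReal_nonneg, ENNReal.ofReal_toReal hkt]
  simp only [hK]
  rw [lintegral_const_mul _ hdm]
  -- By second countability, countably many sets which a translation moves into the chart cover the
  -- whole coordinate space. Made disjoint, they cut `A` into pieces to which `hlocal` applies.
  obtain ⟨s, hsc, hs⟩ := TopologicalSpace.countable_cover_nhds
    (f := fun b : GluonSpace N => {b' | (G.U b)⁻¹ * G.U b' ∈ O}) fun b =>
      (hPo _).mem_nhds (by simpa using hO1)
  have hsne : s.Nonempty := by
    by_contra h
    rw [Set.not_nonempty_iff_eq_empty] at h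
    simp [h] at hs
    exact Set.empty_ne_univ hs
  obtain ⟨x, rfl⟩ := hsc.exists_eq_range hsne
  set P : ℕ → Set (GluonSpace N) := fun m => {b' | (G.U (x m))⁻¹ * G.U b' ∈ O} with hP
  have hPU : ⋃ m, P m = Set.univ := by simpa using hs
  have hPm : ∀ m, MeasurableSet (P m) := fun m => (hPo _).measurableSet
  set B : ℕ → Set (GluonSpace N) := fun m => A ∩ disjointed P m with hB
  have hBm : ∀ m, MeasurableSet (B m) := fun m => hA.inter (MeasurableSet.disjointed hPm m)
  have hBd : Pairwise (Function.onFun Disjoint B) := fun i j hij =>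
    (disjoint_disjointed P hij).mono Set.inter_subset_right Set.inter_subset_right
  have hBU : A = ⋃ m, B m := by
    rw [hB, ← Set.inter_iUnion, iUnion_disjointed, hPU, Set.inter_univ]
  have hBinj : ∀ m, Set.InjOn G.U (B m) := fun m => hinj.mono Set.inter_subset_left
  have h1 : μ (G.U '' A) = ∑' m, μ (G.U '' B m) := by
    conv_lhs => rw [hBU, Set.image_iUnion]
    refine measure_iUnion (fun i j hij => ?_) fun m =>
      (hBm m).image_of_continuousOn_injOn G.continuous_U.continuousOn (hBinj m)
    exact (hBd hij).image hinj Set.inter_subset_left Set.inter_subset_left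
  have h2 : ∫⁻ b in A, d b = ∑' m, ∫⁻ b in B m, d b := by
    conv_lhs => rw [hBU]
    exact lintegral_iUnion hBm hBd d
  rw [h1, h2, ← ENNReal.tsum_mul_left]
  exact tsum_congr fun m => hlocal _ _ (hBm m) (hBinj m) fun b hb =>
    disjointed_subset P m hb.2

end Generators

/-! ### Expansions of `det J` and of `-log det W`, and rescaling. -/

namespace Generators

variable {N : ℕ} {κ : ℝ}

theorem IsLocalProduct.eventually_det_mul {G : Generators N κ} (hN : 2 ≤ N) (hκ : κ ≠ 0)
    {c : GluonSpace N → GluonSpace N → GluonSpace N} (hc : G.IsLocalProduct c) :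
    ∀ᶠ b in 𝓝 0, (G.mcMatrix b).det * (jacobianAtZero c b).det = 1 := by
  filter_upwards [hc.eventually_mcMatrix_mul hN hκ] with b hb
  rw [← det_mul, hb, det_one]

/-- If `d = 1 - m s² + r` with `r = O(s³)`, then `1/d - (1 + m s²) = (m² s⁴ - r (1 + m s²)) / d`,
and `1/d` is bounded near `0`. -/
theorem IsLocalProduct.det_jacobianAtZero_isBigO {G : Generators N κ} (hN : 2 ≤ N) (hκ : 0 < κ)
    {c : GluonSpace N → GluonSpace N → GluonSpace N} (hc : G.IsLocalProduct c) :
    (fun b => (jacobianAtZero c b).det - (1 + κ / 2 * (1 / 6 * G.casimirForm b)))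
      =O[𝓝 0] fun b => ‖b‖ ^ 3 := by
  set m := κ / 2 * (1 / 6 * N) with hm
  set d : GluonSpace N → ℝ := fun b => (G.mcMatrix b).det with hd
  have hr : (fun b => d b - (1 - m * ‖b‖ ^ 2)) =O[𝓝 0] fun b : GluonSpace N => ‖b‖ ^ 3 :=
    G.det_mcMatrix_isBigO_norm hN hκ
  have hdc : ContinuousAt (fun b => (d b)⁻¹) 0 :=
    G.continuous_det_mcMatrix.continuousAt.inv₀ (by
      rw [G.det_mcMatrix_zero hκ.ne']; exact one_ne_zero)
  have h1 : (fun b : GluonSpace N => ‖b‖ ^ 3 * (m ^ 2 * ‖b‖)) =O[𝓝 0] fun b => ‖b‖ ^ 3 * 1 :=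
    (isBigO_refl _ _).mul (Continuous.continuousAt (by fun_prop)).isBigO_one_nhds
  have h2 : (fun b : GluonSpace N => (d b - (1 - m * ‖b‖ ^ 2)) * (1 + m * ‖b‖ ^ 2))
      =O[𝓝 0] fun b => ‖b‖ ^ 3 * 1 :=
    hr.mul (Continuous.continuousAt (by fun_prop)).isBigO_one_nhds
  have h3 := (h1.sub h2).mul hdc.isBigO_one_nhds
  simp only [mul_one] at h3
  refine h3.congr' ?_ EventuallyEq.rfl
  filter_upwards [hc.eventually_det_mul hN hκ.ne'] with b hb
  have hd0 : d b ≠ 0 := left_ne_zero_of_mul_eq_one hb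
  have hJ : (jacobianAtZero c b).det = (d b)⁻¹ := eq_inv_of_mul_eq_one_right hb
  rw [hJ, G.casimirForm_eq hN hκ]
  field_simp
  rw [hm]
  ring

theorem exists_log_det_mcMatrix_bound (G : Generators N κ) (hN : 2 ≤ N) (hκ : 0 < κ) :
    ∃ r C : ℝ, 0 < r ∧ ∀ x : GluonSpace N, ‖x‖ < r → 0 < (G.mcMatrix x).det ∧
      |-Real.log (G.mcMatrix x).det - κ / 2 * (1 / 6 * N) * ‖x‖ ^ 2| ≤ C * ‖x‖ ^ 3 := by
  set m := κ / 2 * (1 / 6 * N) with hm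
  obtain ⟨C, hC, hO⟩ := (G.det_mcMatrix_isBigO_norm hN hκ).exists_nonneg
  have hlim := G.continuous_det_mcMatrix.tendsto 0
  rw [G.det_mcMatrix_zero hκ.ne'] at hlim
  have hhalf := hlim.eventually (lt_mem_nhds (by norm_num : (1 / 2 : ℝ) < 1))
  obtain ⟨r, hr, hball⟩ := Metric.eventually_nhds_iff.1 (hO.bound.and hhalf)
  -- `2 (m + C)²` bounds the remainder of the logarithm and `C` that of `det W`. The radius is at
  -- most `1` so that higher powers of `‖x‖` are dominated by lower ones.
  refine ⟨min r 1, 2 * (m + C) ^ 2 + C, lt_min hr one_pos, fun x hx => ?_⟩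
  have hm0 : 0 ≤ m := by positivity
  have hx1 : ‖x‖ ≤ 1 := (hx.trans_le (min_le_right _ _)).le
  obtain ⟨h1, h2⟩ := hball (y := x) (by simpa using hx.trans_le (min_le_left _ _))
  set d := (G.mcMatrix x).det with hd
  set s := ‖x‖ with hs
  have hs0 : 0 ≤ s := norm_nonneg x
  have hd0 : 0 < d := by linarith
  refine ⟨hd0, ?_⟩
  rw [norm_pow, norm_norm, Real.norm_eq_abs, ← hm] at h1
  have hs32 : s ^ 3 ≤ s ^ 2 := pow_le_pow_of_le_one hs0 hx1 (by norm_num)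
  have hs43 : s ^ 4 ≤ s ^ 3 := pow_le_pow_of_le_one hs0 hx1 (by norm_num)
  have hd1 : |d - 1| ≤ (m + C) * s ^ 2 := by
    have h3 : d - 1 = (d - (1 - m * s ^ 2)) + -(m * s ^ 2) := by ring
    rw [h3]
    refine (abs_add_le _ _).trans ?_
    rw [abs_neg, abs_of_nonneg (by positivity : 0 ≤ m * s ^ 2)]
    nlinarith
  have hsq : (d - 1) ^ 2 ≤ (m + C) ^ 2 * s ^ 3 := by
    calc (d - 1) ^ 2 = |d - 1| ^ 2 := (sq_abs _).symm
      _ ≤ ((m + C) * s ^ 2) ^ 2 := by gcongr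
      _ = (m + C) ^ 2 * s ^ 4 := by ring
      _ ≤ (m + C) ^ 2 * s ^ 3 := by gcongr
  -- From `1 - 1/d ≤ log d ≤ d - 1` the difference is at most `(d - 1)²/d`, and `d > 1/2`.
  have hlog : |(d - 1) - Real.log d| ≤ 2 * (d - 1) ^ 2 := by
    have hu := Real.log_le_sub_one_of_pos hd0
    have hl := Real.one_sub_inv_le_log_of_pos hd0
    rw [abs_of_nonneg (by linarith)]
    have hinv : d - 1 - (1 - d⁻¹) = (d - 1) ^ 2 * d⁻¹ := by field_simp
    have hinv2 : d⁻¹ ≤ 2 := by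
      rw [inv_le_comm₀ hd0 two_pos]; linarith
    nlinarith [mul_le_mul_of_nonneg_left hinv2 (sq_nonneg (d - 1))]
  have h4 : -Real.log d - m * s ^ 2 = ((d - 1) - Real.log d) + -(d - (1 - m * s ^ 2)) := by ring
  rw [h4]
  refine (abs_add_le _ _).trans ?_
  rw [abs_neg]
  linarith

end Generators

/-- The density of a measure in rescaled coordinates. -/
theorem IsDensityInCoordinates.comp_smul {N : ℕ}
    [MeasurableSpace (specialUnitaryGroup (Fin N) ℂ)]
    {μ : Measure (specialUnitaryGroup (Fin N) ℂ)}
    {Φ : GluonSpace N → specialUnitaryGroup (Fin N) ℂ} {ρ : GluonSpace N → ℝ}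
    (h : IsDensityInCoordinates μ Φ ρ) {g : ℝ} (hg : 0 < g) :
    IsDensityInCoordinates μ (fun A => Φ (g • A)) (fun A => g ^ (N ^ 2 - 1) * ρ (g • A)) := by
  refine ⟨fun b => mul_nonneg (by positivity) (h.1 _), fun A hA hinj => ?_⟩
  have hsinj : Set.InjOn (fun x : GluonSpace N => g • x) A :=
    (smul_right_injective _ hg.ne').injOn
  have himage : (fun A => Φ (g • A)) '' A = Φ '' ((fun x => g • x) '' A) := by
    rw [Set.image_image]
  have hAm : MeasurableSet ((fun x : GluonSpace N => g • x) '' A) := hA.const_smul₀ g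
  have hinj' : Set.InjOn Φ ((fun x => g • x) '' A) := by
    rintro _ ⟨a, ha, rfl⟩ _ ⟨a', ha', rfl⟩ haa
    rw [hinj ha ha' haa]
  have hderiv : ∀ x ∈ A, HasFDerivWithinAt (fun x : GluonSpace N => g • x)
      (g • ContinuousLinearMap.id ℝ (GluonSpace N)) A x := fun x _ =>
    ((hasFDerivAt_id x).const_smul g).hasFDerivWithinAt
  rw [himage, h.2 _ hAm hinj',
    lintegral_image_eq_lintegral_abs_det_fderiv_mul volume hA hderiv hsinj]
  refine setLIntegral_congr_fun hA fun b _ => ?_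
  have hdet : (g • ContinuousLinearMap.id ℝ (GluonSpace N)).det = g ^ (N ^ 2 - 1) := by
    have := LinearMap.det_smul g (LinearMap.id : GluonSpace N →ₗ[ℝ] GluonSpace N)
    rw [LinearMap.det_id, mul_one, finrank_euclideanSpace, Fintype.card_fin] at this
    exact this
  rw [hdet, abs_of_nonneg (by positivity), ENNReal.ofReal_mul (by positivity)]

end

theorem mainTheorem6 (N : ℕ) (hN : 2 ≤ N) (κ : ℝ) (hκ : 0 < κ) (G : Generators N κ)
    [MeasurableSpace (specialUnitaryGroup (Fin N) ℂ)] [BorelSpace (specialUnitaryGroup (Fin N) ℂ)]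
    (μ : Measure (specialUnitaryGroup (Fin N) ℂ)) [μ.IsHaarMeasure] [IsProbabilityMeasure μ] :
    -- structure constants and Casimir matrix
    ((∀ i j, G.θ i * G.θ j - G.θ j * G.θ i
        = (Complex.I * (√(2 * κ) : ℝ)) • ∑ k, (G.f i j k : ℂ) • G.θ k) ∧
      (∀ i j k, G.f i j k = -G.f j i k ∧ G.f i j k = -G.f i k j) ∧
      G.casimir = (N : ℝ) • (1 : Matrix (Fin (N ^ 2 - 1)) (Fin (N ^ 2 - 1)) ℝ)) ∧
    -- `b ↦ exp (i b · θ)` is a coordinate system near the identity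
    (∃ V : Set (GluonSpace N), IsOpen V ∧ 0 ∈ V ∧ Set.InjOn G.U V ∧ IsOpen (G.U '' V)) ∧
    -- the product in these coordinates exists near `(0, 0)`
    (∃ c, G.IsLocalProduct c) ∧
    -- expansion of `det J`
    (∀ c, G.IsLocalProduct c →
      AnalyticAt ℝ (fun p : GluonSpace N × GluonSpace N => c p.1 p.2) (0, 0) ∧
      (fun b => (jacobianAtZero c b).det - (1 + κ / 2 * (1 / 6 * G.casimirForm b)))
        =O[𝓝 0] fun b => ‖b‖ ^ 3) ∧
    -- the Maurer-Cartan form takes values in the Lie algebra and is real analytic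
    ((∀ b v, G.maurerCartan b v
        = Complex.I • ∑ j, ((∑ k, G.mcMatrix b j k * v k : ℝ) : ℂ) • G.θ j) ∧
      ∀ j k, AnalyticOnNhd ℝ (fun b => G.mcMatrix b j k) Set.univ) ∧
    -- the Haar density
    ∃ K : ℝ, 0 < K ∧ ∃ ρ : GluonSpace N → ℝ,
      IsDensityInCoordinates μ G.U ρ ∧
      AnalyticOnNhd ℝ ρ Set.univ ∧
      (∀ b, ρ b = K * (G.mcMatrix b).det) ∧
      (∀ c, G.IsLocalProduct c →
        ∀ᶠ b in 𝓝 0, 0 < (jacobianAtZero c b).det ∧ ρ b = K / (jacobianAtZero c b).det) ∧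
      -- mass term of the exponent of the density, for `U = exp (i g A · θ)`
      (∀ g : ℝ, 0 < g →
        IsDensityInCoordinates μ (fun A => G.U (g • A)) (fun A => g ^ (N ^ 2 - 1) * ρ (g • A))) ∧
      ∃ r C : ℝ, 0 < r ∧ ∀ g : ℝ, 0 < g → ∀ A : GluonSpace N, ‖g • A‖ < r →
        0 < ρ (g • A) ∧
        |-Real.log (g ^ (N ^ 2 - 1) * ρ (g • A)) -
            (-Real.log (g ^ (N ^ 2 - 1) * K) + g ^ 2 * (κ / 2 * (1 / 6 * N)) * ‖A‖ ^ 2)|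
          ≤ C * ‖g • A‖ ^ 3 := by
  obtain ⟨K, hK, hdens⟩ := G.exists_haar_eq_setLIntegral hN hκ.ne' μ
  have hρ : IsDensityInCoordinates μ G.U fun b => K * (G.mcMatrix b).det :=
    ⟨fun b => mul_nonneg hK.le (G.det_mcMatrix_nonneg hN hκ.ne' b), hdens⟩
  refine ⟨⟨G.commutator_eq hN hκ, fun i j k => ⟨G.f_swap_left i j k, G.f_swap_right i j k⟩,
    G.casimir_eq hN hκ⟩, ?_, G.exists_isLocalProduct hN hκ.ne',
    fun c hc => ⟨hc.analyticAt hN hκ.ne', hc.det_jacobianAtZero_isBigO hN hκ⟩,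
    ⟨G.maurerCartan_eq_sum hN hκ.ne', fun j k b _ => G.analyticAt_mcMatrix b j k⟩,
    K, hK, fun b => K * (G.mcMatrix b).det, hρ,
    fun b _ => analyticAt_const.mul (G.analyticAt_det_mcMatrix b), fun _ => rfl, ?_,
    fun g hg => hρ.comp_smul hg, ?_⟩
  · obtain ⟨V, L, -, hVo, h0, hLV, hO, -⟩ := G.exists_chart hN hκ.ne' univ_mem
    exact ⟨V, hVo, h0, fun b hb b' hb' h => by rw [← hLV b hb, ← hLV b' hb', h], hO⟩
  · intro c hc
    filter_upwards [hc.eventually_det_mul hN hκ.ne'] with b hb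
    have hd0 : 0 < (G.mcMatrix b).det :=
      lt_of_le_of_ne (G.det_mcMatrix_nonneg hN hκ.ne' b) (left_ne_zero_of_mul_eq_one hb).symm
    have hJ : (jacobianAtZero c b).det = (G.mcMatrix b).det⁻¹ := eq_inv_of_mul_eq_one_right hb
    rw [hJ, div_inv_eq_mul]
    exact ⟨inv_pos.2 hd0, rfl⟩
  · obtain ⟨r, C, hr, h⟩ := G.exists_log_det_mcMatrix_bound hN hκ
    -- The bound is used at the point `gA`, so `r` and `C` do not depend on `g`.
    refine ⟨r, C, hr, fun g hg A hA => ?_⟩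
    obtain ⟨hd, hbound⟩ := h (g • A) hA
    refine ⟨mul_pos hK hd, ?_⟩
    have hgK : g ^ (N ^ 2 - 1) * K ≠ 0 := by positivity
    have hnorm : ‖g • A‖ ^ 2 = g ^ 2 * ‖A‖ ^ 2 := by
      rw [norm_smul, mul_pow, Real.norm_eq_abs, sq_abs]
    rw [← mul_assoc, Real.log_mul hgK hd.ne']
    rw [hnorm] at hbound
    convert hbound using 2
    ring
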